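/- Let $\upsilon,\lambda,b\in\mathbb{C}$ and $y\in\mathbb{R}$ with $\Re(\upsilon)>0$, $y>0$, $\Re(\lambda)>0$, $\Re(b)>0$, and suppose moreover that $\Re(\lambda)<2\Re(\upsilon)$ and $\Re(\lambda b)>0$ (these two conditions express the absolute convergence of the following integral at $0$ and at $\infty$; the second is automatic if $\lambda$ or $b$ is real). Put $$I_C(\upsilon,b,\lambda,y)=\int_0^\infty\frac{x^{\upsilon-1}\cos(xy)}{\{\exp(b\sqrt{x})-1\}^{\lambda}}\,dx ,$$ where the power is $\exp(\lambda L(x))$ with $L$ the logarithm of $\exp(b\sqrt x)-1$ that is continuous on $(0,\infty)$ and principal for all small $x>0$ (so the principal power for real $b$). Let $(\lambda)_k=\lambda(\lambda+1)\cdots(\lambda+k-1)$ and $s_k=\lambda b+bk$. Then the integral converges absolutely, and the following five series converge absolutely and satisfy $$I_C(\upsilon,b,\lambda,y)=\frac{2^{4\upsilon-\frac32}}{\pi}\sum_{k=0}^\infty\frac{(\lambda)_k}{k!\,s_k^{2\upsilon}}\,G^{1,4}_{4,2}\!\left(\frac{64y^2}{s_k^4}\,\middle|\,{\tfrac{4-2\upsilon}{4},\tfrac{3-2\upsilon}{4},\tfrac{2-2\upsilon}{4},\tfrac{1-2\upsilon}{4};-\atop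 0;\ \tfrac12}\right)$$ $$=\frac{2^{4\upsilon}\sqrt{y}}{\pi}\sum_{k=0}^\infty\frac{(\lambda)_k}{k!\,s_k^{2\upsilon+1}}\,G^{1,4}_{4,2}\!\left(\frac{64y^2}{s_k^4}\,\middle|\,{\tfrac{3-2\upsilon}{4},\tfrac{2-2\upsilon}{4},\tfrac{1-2\upsilon}{4},\tfrac{-2\upsilon}{4};-\atop -\tfrac14;\ \tfrac14}\right)$$ $$=\frac{2^{4\upsilon-\frac92}}{\pi y}\sum_{k=0}^\infty\frac{(\lambda)_k}{k!\,s_k^{2\upsilon-2}}\,G^{1,4}_{4,2}\!\left(\frac{64y^2}{s_k^4}\,\middle|\,{\tfrac{6-2\upsilon}{4},\tfrac{5-2\upsilon}{4},\tfrac{4-2\upsilon}{4},\tfrac{3-2\upsilon}{4};-\atop \tfrac12;\ 1}\right)$$ $$=\frac{y\,2^{4\upsilon+\frac32}}{\pi}\sum_{k=0}^\infty\frac{(\lambda)_k}{k!\,s_k^{2\upsilon+2}}\,G^{1,4}_{4,2}\!\left(\frac{64y^2}{s_k^4}\,\middle|\,{\tfrac{2-2\upsilon}{4},\tfrac{1-2\upsilon}{4},\tfrac{-2\upsilon}{4},\tfrac{-1-2\upsilon}{4};-\atop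 -\tfrac12;\ 0}\right)$$ $$=\frac{2^{6\upsilon-\frac72}}{\pi^3}\sum_{k=0}^\infty\frac{(\lambda)_k}{k!\,s_k^{2\upsilon}}\,G^{2,8}_{8,4}\!\left(\frac{4^8y^4}{s_k^8}\,\middle|\,{\tfrac{8-2\upsilon}{8},\tfrac{7-2\upsilon}{8},\tfrac{6-2\upsilon}{8},\tfrac{5-2\upsilon}{8},\tfrac{4-2\upsilon}{8},\tfrac{3-2\upsilon}{8},\tfrac{2-2\upsilon}{8},\tfrac{1-2\upsilon}{8};-\atop 0,\tfrac12;\ \tfrac14,\tfrac34}\right).$$ Here powers of $s_k$ (note $\Re(s_k)>0$) are principal, and $$G^{m,n}_{p,q}\!\left(z\,\middle|\,{\alpha_1,\dots,\alpha_n;\alpha_{n+1},\dots,\alpha_p\atop\beta_1,\dots,\beta_m;\beta_{m+1},\dots,\beta_q}\right)=\frac1{2\pi i}\int_{\mathcal L}\frac{\prod_{j=1}^m\Gamma(\beta_j-\zeta)\prod_{j=1}^n\Gamma(1-\alpha_j+\zeta)}{\prod_{j=m+1}^q\Gamma(1-\beta_j+\zeta)\prod_{j=n+1}^p\Gamma(\alpha_j-\zeta)}\,z^\zeta\,d\zeta$$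 is the Meijer $G$-function, where $\mathcal L$ is any upward vertical line with the poles of the $\Gamma(\beta_j-\zeta)$, $j\le m$, on its right and those of the $\Gamma(1-\alpha_j+\zeta)$, $j\le n$, on its left (such lines exist for the parameters above, and the integral converges absolutely and does not depend on the line). For $z=A/s_k^r$ with $A>0$, $z^\zeta$ means $\exp(\zeta(\log A-r\operatorname{Log}s_k))$, that is, $\arg z=-r\arg s_k\in(-\tfrac{r\pi}{2},\tfrac{r\pi}{2})$. -/

import Mathlib

open MeasureTheory Set

/-! ### The power `(exp (b √x) - 1) ^ (-lam)` for complex `b` with positive real part -/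

/-- The logarithm of `exp (b √x) - 1` that is continuous in `x > 0` and equal to the principal
logarithm for all small `x > 0` (and for all `x > 0` when `b` is real); see the lemmas below. -/
noncomputable def expSubOneLog (b : ℂ) (x : ℝ) : ℂ :=
  b * (Real.sqrt x : ℂ) + Complex.log (1 - Complex.exp (-(b * (Real.sqrt x : ℂ))))

theorem re_one_sub_exp_pos {b : ℂ} (hb : 0 < b.re) {x : ℝ} (hx : 0 < x) :
    0 < (1 - Complex.exp (-(b * (Real.sqrt x : ℂ)))).re := by
  have h1 : ‖Complex.exp (-(b * (Real.sqrt x : ℂ)))‖ < 1 := by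
    rw [Complex.norm_exp, Real.exp_lt_one_iff]
    simpa using mul_pos hb (Real.sqrt_pos.mpr hx)
  have h2 := (Complex.re_le_norm (Complex.exp (-(b * (Real.sqrt x : ℂ))))).trans_lt h1
  simpa using h2

/-- It is a logarithm of `exp (b √x) - 1`. -/
theorem exp_expSubOneLog {b : ℂ} (hb : 0 < b.re) {x : ℝ} (hx : 0 < x) :
    Complex.exp (expSubOneLog b x) = Complex.exp (b * (Real.sqrt x : ℂ)) - 1 := by
  have h := re_one_sub_exp_pos hb hx
  have h0 : (1 - Complex.exp (-(b * (Real.sqrt x : ℂ)))) ≠ 0 := by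
    intro h'
    rw [h'] at h
    simp at h
  rw [expSubOneLog, Complex.exp_add, Complex.exp_log h0, mul_sub, ← Complex.exp_add]
  simp

/-- It is continuous on the positive half-line. -/
theorem continuousOn_expSubOneLog {b : ℂ} (hb : 0 < b.re) :
    ContinuousOn (expSubOneLog b) (Ioi 0) := by
  unfold expSubOneLog
  refine ContinuousOn.add (by fun_prop) (ContinuousOn.clog (by fun_prop) ?_)
  intro x hx
  exact Or.inl (re_one_sub_exp_pos hb hx)

/-- It is the principal logarithm as long as `|Im b| √x ≤ π / 2`, so for all small `x`, and for
all `x > 0` if `b` is real. -/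
theorem expSubOneLog_eq_log {b : ℂ} (hb : 0 < b.re) {x : ℝ} (hx : 0 < x)
    (h : |b.im| * Real.sqrt x ≤ Real.pi / 2) :
    expSubOneLog b x = Complex.log (Complex.exp (b * (Real.sqrt x : ℂ)) - 1) := by
  rw [← exp_expSubOneLog hb hx]
  have h1 := (Complex.abs_arg_lt_pi_div_two_iff).mpr (Or.inl (re_one_sub_exp_pos hb hx))
  have him : (expSubOneLog b x).im = b.im * Real.sqrt x
      + Complex.arg (1 - Complex.exp (-(b * (Real.sqrt x : ℂ)))) := by
    simp [expSubOneLog, Complex.log_im]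
  have h2 : |b.im * Real.sqrt x| ≤ Real.pi / 2 := by
    rwa [abs_mul, abs_of_nonneg (Real.sqrt_nonneg x)]
  rw [abs_lt] at h1
  rw [abs_le] at h2
  rw [Complex.log_exp] <;> rw [him] <;> linarith [h1.1, h1.2, h2.1, h2.2]

/-- The integrand `x ^ (υ - 1) cos (x y) / (exp (b √x) - 1) ^ lam`. -/
noncomputable def ramanujanIntegrand (υ b lam : ℂ) (y : ℝ) (x : ℝ) : ℂ :=
  (x : ℂ) ^ (υ - 1) * (Real.cos (x * y) : ℂ) / Complex.exp (lam * expSubOneLog b x)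

/-- The generalized Ramanujan integral `I_C (υ, b, lam, y)`. -/
noncomputable def ramanujanIC (υ b lam : ℂ) (y : ℝ) : ℂ :=
  ∫ x in Ioi (0 : ℝ), ramanujanIntegrand υ b lam y x

/-! ### The Meijer G-function

The argument `z ≠ 0` enters through a logarithm `w` of `z`, with `z ^ ζ = exp (ζ w)`: the sector
`|arg z| < π (m + n - (p + q) / 2)` on which the function is defined can be wider than `2 π`, so it
lies on the Riemann surface of the logarithm. -/

/-- The quotient of products of Gamma functions in the Mellin-Barnes integral of `G^{m,n}_{p,q}`
with upper parameters `α` and lower parameters `β`. -/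
noncomputable def meijerGKernel {p q : ℕ} (m n : ℕ) (α : Fin p → ℂ) (β : Fin q → ℂ) (ζ : ℂ) : ℂ :=
  ((∏ j ∈ Finset.univ.filter (fun j : Fin q => (j : ℕ) < m), Complex.Gamma (β j - ζ)) *
      ∏ j ∈ Finset.univ.filter (fun j : Fin p => (j : ℕ) < n), Complex.Gamma (1 - α j + ζ)) /
    ((∏ j ∈ Finset.univ.filter (fun j : Fin q => m ≤ (j : ℕ)), Complex.Gamma (1 - β j + ζ)) *
      ∏ j ∈ Finset.univ.filter (fun j : Fin p => n ≤ (j : ℕ)), Complex.Gamma (α j - ζ))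

/-- The vertical line `Re ζ = σ` has all poles `β j + N` of the factors `Γ (β j - ζ)`, `j < m`, on
its right and all poles `α j - 1 - N` of the factors `Γ (1 - α j + ζ)`, `j < n`, on its left. -/
def MeijerGSeparates {p q : ℕ} (m n : ℕ) (α : Fin p → ℂ) (β : Fin q → ℂ) (σ : ℝ) : Prop :=
  (∀ j : Fin q, (j : ℕ) < m → ∀ N : ℕ, σ < (β j + (N : ℂ)).re) ∧
    ∀ j : Fin p, (j : ℕ) < n → ∀ N : ℕ, (α j - 1 - (N : ℂ)).re < σ

/-- `g` is the value of `G^{m,n}_{p,q} (z | α; β)`, where `w` is a logarithm of `z`: there are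
vertical lines that separate the two families of poles, and along each of them (upwards) the
integral `1 / (2 π i) ∫ kernel ζ * z ^ ζ dζ` converges absolutely and has the value `g`. -/
def HasMeijerG {p q : ℕ} (m n : ℕ) (α : Fin p → ℂ) (β : Fin q → ℂ) (w g : ℂ) : Prop :=
  (∃ σ : ℝ, MeijerGSeparates m n α β σ) ∧
    ∀ σ : ℝ, MeijerGSeparates m n α β σ →
      Integrable (fun τ : ℝ => meijerGKernel m n α β ((σ : ℂ) + (τ : ℂ) * Complex.I) *
        Complex.exp (((σ : ℂ) + (τ : ℂ) * Complex.I) * w)) ∧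
      1 / (2 * (Real.pi : ℂ) * Complex.I) *
        ∫ τ : ℝ, meijerGKernel m n α β ((σ : ℂ) + (τ : ℂ) * Complex.I) *
          Complex.exp (((σ : ℂ) + (τ : ℂ) * Complex.I) * w) * Complex.I = g

/-- The Mellin-Barnes integral that defines the G-function converges. -/
def MeijerGExists {p q : ℕ} (m n : ℕ) (α : Fin p → ℂ) (β : Fin q → ℂ) (w : ℂ) : Prop :=
  ∃ g : ℂ, HasMeijerG m n α β w g

open Classical in
/-- The Meijer G-function `G^{m,n}_{p,q} (z | α; β)` at `z = exp w` (and `0` where the defining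
integral does not exist). -/
noncomputable def meijerG {p q : ℕ} (m n : ℕ) (α : Fin p → ℂ) (β : Fin q → ℂ) (w : ℂ) : ℂ :=
  if h : MeijerGExists m n α β w then h.choose else 0

theorem HasMeijerG.meijerG_eq {p q : ℕ} {m n : ℕ} {α : Fin p → ℂ} {β : Fin q → ℂ} {w g : ℂ}
    (h : HasMeijerG m n α β w g) : meijerG m n α β w = g := by
  have hex : MeijerGExists m n α β w := ⟨g, h⟩
  obtain ⟨σ, hσ⟩ := h.1
  rw [meijerG, dif_pos hex]
  exact ((hex.choose_spec.2 σ hσ).2).symm.trans (h.2 σ hσ).2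

/-- The logarithm of `A / s ^ r` whose argument is `- r * arg s`, where `A > 0` and `arg` is the
principal argument. -/
noncomputable def logDivPow (A : ℝ) (s : ℂ) (r : ℕ) : ℂ :=
  (Real.log A : ℂ) - (r : ℂ) * Complex.log s

theorem exp_logDivPow {A : ℝ} (hA : 0 < A) {s : ℂ} (hs : s ≠ 0) (r : ℕ) :
    Complex.exp (logDivPow A s r) = (A : ℂ) / s ^ r := by
  rw [logDivPow, Complex.exp_sub, Complex.exp_nat_mul, Complex.exp_log hs, ← Complex.ofReal_exp,
    Real.exp_log hA]

/-- The coefficient `(lam)_k / k!` of the binomial series. -/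
noncomputable def pochhammerCoeff (lam : ℂ) (k : ℕ) : ℂ :=
  (ascPochhammer ℂ k).eval lam / (Nat.factorial k : ℂ)

/-- `I = C * ∑ k, c k * G^{m,n}_{p,q} (exp (w k) | α; β)`, where all the G-functions exist and the
series converges absolutely. -/
def IsMeijerGSeries {p q : ℕ} (I C : ℂ) (c : ℕ → ℂ) (m n : ℕ) (α : Fin p → ℂ) (β : Fin q → ℂ)
    (w : ℕ → ℂ) : Prop :=
  (∀ k : ℕ, MeijerGExists m n α β (w k)) ∧
    (Summable fun k : ℕ => c k * meijerG m n α β (w k)) ∧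
    I = C * ∑' k : ℕ, c k * meijerG m n α β (w k)

/-! ### Bounds for the Gamma function on vertical lines -/

/-! With q = exp(-b√x), the integrand is x^(υ-1) cos(xy) exp(-lam b √x) (1-q)^(-lam). The binomial
series in q, integrated termwise, gives the sum of (lam)_k/k! · J(s_k), where J(s) = ∫ x^(υ-1)
cos(xy) exp(-s√x) dx is `cosLaplaceSqrt`. The interchange is legitimate because (lam)_k/k! = O(k^(Re
lam - 1)), while the k-th integral of absolute values is O((Re s_k)^(-2 Re υ)); the total converges
because Re lam < 2 Re υ (`ramanujanIntegrand_integrable_and_hasSum`).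

Each J(s) is a G-function. Write exp(-s√x) as an inverse Mellin integral of Γ(u) s^(-u) and
integrate over x first. For the cosine itself the double integral is not absolutely convergent, so
the computation is done with exp(-px), Re p > 0, and then p tends to ±iy. The substitution u = 2υ +
4ζ, Gauss's multiplication formula, duplication and reflection turn the result into the kernel of
G^{1,4}_{4,2} (`hasMeijerG_one_four`).

The other four series are the same one in disguise: translating ζ multiplies G by a power of its
argument (`HasMeijerG.add_const`), and replacing ζ by 2ζ with duplication of every Gamma factor
gives G^{2,8}_{8,4} (`HasMeijerG.two_eight`). -/

theorem norm_cexp_neg_mul_log (u : ℂ) {r : ℂ} (hr : r ≠ 0) :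
    ‖Complex.exp (-u * Complex.log r)‖ = ‖r‖ ^ (-u.re) * Real.exp (r.arg * u.im) := by
  rw [Complex.norm_exp, Real.rpow_def_of_pos (norm_pos_iff.mpr hr), ← Real.exp_add]
  congr 1
  simp [Complex.mul_re, Complex.log_re, Complex.log_im]
  ring

theorem norm_cpow_mul_cexp_neg_mul (a r : ℂ) {x : ℝ} (hx : 0 < x) :
    ‖(x : ℂ) ^ (a - 1) * Complex.exp (-(r * x))‖ =
      x ^ (a.re - 1) * Real.exp (-(r.re * x)) := by
  rw [norm_mul, Complex.norm_cpow_eq_rpow_re_of_pos hx, Complex.norm_exp]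
  simp

theorem integrableOn_rpow_mul_exp_neg_mul {a r : ℝ} (ha : 0 < a) (hr : 0 < r) :
    IntegrableOn (fun x : ℝ => x ^ (a - 1) * Real.exp (-(r * x))) (Ioi 0) := by
  have h := integrableOn_rpow_mul_exp_neg_mul_rpow (s := a - 1) (by linarith) one_pos hr
  simpa using h

theorem integrableOn_cpow_mul_cexp_neg_mul {a r : ℂ} (ha : 0 < a.re) (hr : 0 < r.re) :
    IntegrableOn (fun x : ℝ => (x : ℂ) ^ (a - 1) * Complex.exp (-(r * x))) (Ioi 0) := by
  refine Integrable.mono' (integrableOn_rpow_mul_exp_neg_mul ha hr) ?_ ?_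
  · exact (by fun_prop : Measurable fun x : ℝ =>
      (x : ℂ) ^ (a - 1) * Complex.exp (-(r * x))).aestronglyMeasurable
  · filter_upwards [ae_restrict_mem measurableSet_Ioi] with x hx
    exact (norm_cpow_mul_cexp_neg_mul a r hx).le

theorem differentiableAt_integral_cpow_mul_cexp_neg_mul {a r : ℂ} (ha : 0 < a.re)
    (hr : 0 < r.re) :
    DifferentiableAt ℂ
      (fun r : ℂ => ∫ x in Ioi (0 : ℝ), (x : ℂ) ^ (a - 1) * Complex.exp (-(r * x))) r := by
  -- On this half-plane exp(-(Re r / 2) x) dominates all exponentials at once, which gives a bound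
  -- for the derivative uniform in z.
  have hs : {z : ℂ | r.re / 2 < z.re} ∈ nhds r :=
    (isOpen_lt continuous_const Complex.continuous_re).mem_nhds (by simp; linarith)
  refine (hasDerivAt_integral_of_dominated_loc_of_deriv_le (𝕜 := ℂ)
    (F := fun (r : ℂ) (x : ℝ) => (x : ℂ) ^ (a - 1) * Complex.exp (-(r * x)))
    (F' := fun (r : ℂ) (x : ℝ) => (x : ℂ) ^ (a - 1) * (Complex.exp (-(r * x)) * (-x)))
    (bound := fun x : ℝ => x ^ (a.re + 1 - 1) * Real.exp (-(r.re / 2 * x))) hs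
    (.of_forall fun z => ?_) (integrableOn_cpow_mul_cexp_neg_mul ha hr) ?_ ?_
    (integrableOn_rpow_mul_exp_neg_mul (by linarith) (half_pos hr)) ?_).2.differentiableAt
  · exact (by fun_prop : Measurable fun x : ℝ =>
      (x : ℂ) ^ (a - 1) * Complex.exp (-(z * x))).aestronglyMeasurable
  · exact (by fun_prop : Measurable fun x : ℝ =>
      (x : ℂ) ^ (a - 1) * (Complex.exp (-(r * x)) * (-x))).aestronglyMeasurable
  · filter_upwards [ae_restrict_mem measurableSet_Ioi] with x hx z hz
    have hx : 0 < x := hx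
    rw [← mul_assoc, norm_mul, norm_cpow_mul_cexp_neg_mul a z hx, norm_neg, Complex.norm_real,
      Real.norm_of_nonneg hx.le, add_sub_right_comm, Real.rpow_add_one hx.ne', mul_right_comm]
    have hz : r.re / 2 < z.re := hz
    gcongr
  · refine .of_forall fun x z _ => ?_
    refine HasDerivAt.const_mul _ (HasDerivAt.cexp ?_)
    simpa using! ((hasDerivAt_id z).mul_const (x : ℂ)).neg

/-- Both sides are analytic in r on the right half-plane and agree for real r > 0. Real points
accumulate at 1, so the identity theorem applies. -/
theorem integral_cpow_mul_cexp_neg_mul {a r : ℂ} (ha : 0 < a.re) (hr : 0 < r.re) :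
    ∫ x in Ioi (0 : ℝ), (x : ℂ) ^ (a - 1) * Complex.exp (-(r * x)) =
      Complex.Gamma a * Complex.exp (-a * Complex.log r) := by
  have hopen : IsOpen {z : ℂ | 0 < z.re} := isOpen_lt continuous_const Complex.continuous_re
  have h1 : AnalyticOnNhd ℂ
      (fun r : ℂ => ∫ x in Ioi (0 : ℝ), (x : ℂ) ^ (a - 1) * Complex.exp (-(r * x)))
      {z : ℂ | 0 < z.re} :=
    DifferentiableOn.analyticOnNhd (fun z hz =>
      (differentiableAt_integral_cpow_mul_cexp_neg_mul ha hz).differentiableWithinAt) hopen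
  have h2 : AnalyticOnNhd ℂ (fun r : ℂ => Complex.Gamma a * Complex.exp (-a * Complex.log r))
      {z : ℂ | 0 < z.re} := by
    refine DifferentiableOn.analyticOnNhd (fun z hz => ?_) hopen
    have : z ∈ Complex.slitPlane := Or.inl hz
    exact (((differentiableAt_id.clog this).const_mul (-a)).cexp.const_mul
      (Complex.Gamma a)).differentiableWithinAt
  suffices h : ∃ᶠ z in nhdsWithin (1 : ℂ) {1}ᶜ,
      (∫ x in Ioi (0 : ℝ), (x : ℂ) ^ (a - 1) * Complex.exp (-(z * x))) =
        Complex.Gamma a * Complex.exp (-a * Complex.log z) from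
    h1.eqOn_of_preconnected_of_frequently_eq h2 (convex_halfSpace_re_gt 0).isPreconnected
      (z₀ := 1) (by simp) h hr
  have ht : Filter.Tendsto (fun t : ℝ => (t : ℂ)) (nhdsWithin 1 {1}ᶜ) (nhdsWithin 1 {1}ᶜ) := by
    refine tendsto_nhdsWithin_iff.mpr ⟨?_, ?_⟩
    · exact (Complex.continuous_ofReal.tendsto' 1 1 (by simp)).mono_left nhdsWithin_le_nhds
    · filter_upwards [self_mem_nhdsWithin] with t ht
      simpa using ht
  refine ht.frequently (Filter.Eventually.frequently ?_)
  filter_upwards [nhdsWithin_le_nhds (Ioi_mem_nhds (zero_lt_one' ℝ))] with t ht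
  have ht : 0 < t := ht
  rw [Complex.integral_cpow_mul_exp_neg_mul_Ioi ha ht, one_div,
    Complex.cpow_def_of_ne_zero (inv_ne_zero (Complex.ofReal_ne_zero.mpr ht.ne')),
    Complex.log_inv, mul_comm]
  · congr 2; ring
  · rw [Complex.arg_ofReal_of_nonneg ht.le]; exact Real.pi_pos.ne

theorem norm_Gamma_mul_cexp_neg_mul_log_le {a r : ℂ} (ha : 0 < a.re) (hr : 0 < r.re) :
    ‖Complex.Gamma a * Complex.exp (-a * Complex.log r)‖ ≤
      (1 / r.re) ^ a.re * Real.Gamma a.re := by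
  rw [← integral_cpow_mul_cexp_neg_mul ha hr, ← Real.integral_rpow_mul_exp_neg_mul_Ioi ha hr]
  refine (norm_integral_le_integral_norm _).trans_eq ?_
  exact setIntegral_congr_fun measurableSet_Ioi fun x hx => norm_cpow_mul_cexp_neg_mul a r hx

/-- Rotating Euler's integral replaces Stirling's formula: for r = exp(iφ) the factor r^(-a) has
norm exp(φ Im a) and Re r = cos φ. Choosing φ = ±|θ| according to the sign of Im a gives decay at
any rate below π/2. -/
theorem norm_Gamma_le {a : ℂ} (ha : 0 < a.re) {θ : ℝ} (hθ : |θ| < Real.pi / 2) :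
    ‖Complex.Gamma a‖ ≤
      (1 / Real.cos θ) ^ a.re * Real.Gamma a.re * Real.exp (-(|θ| * |a.im|)) := by
  suffices h : ∀ φ : ℝ, |φ| < Real.pi / 2 →
      ‖Complex.Gamma a‖ ≤ (1 / Real.cos φ) ^ a.re * Real.Gamma a.re * Real.exp (-(φ * a.im)) by
    rcases le_total 0 a.im with h0 | h0
    · have := h |θ| (by rwa [abs_abs])
      rwa [Real.cos_abs, ← abs_of_nonneg h0] at this
    · have := h (-|θ|) (by rwa [abs_neg, abs_abs])
      rwa [Real.cos_neg, Real.cos_abs, neg_mul, ← mul_neg, ← abs_of_nonpos h0] at this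
  intro φ hφ
  have hφ' := abs_lt.mp hφ
  have hlog : Complex.log (Complex.exp (φ * Complex.I)) = φ * Complex.I :=
    Complex.log_exp (by simp; linarith [Real.pi_pos]) (by simp; linarith [Real.pi_pos])
  have hre : (Complex.exp (φ * Complex.I)).re = Real.cos φ := Complex.exp_ofReal_mul_I_re φ
  have h := norm_Gamma_mul_cexp_neg_mul_log_le ha (r := Complex.exp (φ * Complex.I))
    (by rw [hre]; exact Real.cos_pos_of_mem_Ioo hφ')
  rw [hlog, hre, norm_mul, Complex.norm_exp] at h
  have hexp : (-a * (φ * Complex.I)).re = φ * a.im := by simp [Complex.mul_re]; ring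
  rw [hexp] at h
  rw [Real.exp_neg, ← div_eq_mul_inv, le_div_iff₀ (Real.exp_pos _)]
  exact h

theorem continuous_Gamma_of_re_pos {f : ℝ → ℂ} (hf : Continuous f) (h : ∀ τ, 0 < (f τ).re) :
    Continuous fun τ => Complex.Gamma (f τ) := by
  refine continuous_iff_continuousAt.mpr fun τ => ?_
  refine ContinuousAt.comp (f := f) ?_ hf.continuousAt
  refine (Complex.differentiableAt_Gamma _ fun m hm => ?_).continuousAt
  have := h τ
  rw [hm] at this
  simp at this
  linarith [(Nat.cast_nonneg m : (0 : ℝ) ≤ m)]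

theorem integrable_exp_neg_mul_abs {k : ℝ} (hk : 0 < k) :
    Integrable fun τ : ℝ => Real.exp (-(k * |τ|)) := by
  rw [← integrableOn_univ, ← Iic_union_Ioi (a := (0 : ℝ)), integrableOn_union]
  constructor
  · refine (integrableOn_exp_mul_Iic hk 0).congr_fun (fun x hx => ?_) measurableSet_Iic
    simp [abs_of_nonpos (mem_Iic.mp hx)]
  · refine (integrableOn_exp_mul_Ioi (neg_lt_zero.mpr hk) 0).congr_fun (fun x hx => ?_)
      measurableSet_Ioi
    simp [abs_of_pos (mem_Ioi.mp hx)]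

/-! ### The Mellin–Barnes representation of `∫ x ^ (υ - 1) exp (- p x - s √x) dx` -/

/-- The integrand of the Mellin–Barnes integral. -/
noncomputable def expSqrtKernel (υ s p u : ℂ) : ℂ :=
  Complex.Gamma u * Complex.exp (-u * Complex.log s) *
    (Complex.Gamma (υ - u / 2) * Complex.exp (-(υ - u / 2) * Complex.log p))

theorem abs_arg_lt_of_re_pos {s : ℂ} (hs : 0 < s.re) : |s.arg| < Real.pi / 2 :=
  Complex.abs_arg_lt_pi_div_two_iff.mpr (Or.inl hs)

/-- A bound for the kernel that is integrable and locally uniform in `p`. -/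
theorem norm_expSqrtKernel_le {υ s : ℂ} {c : ℝ} (hs : 0 < s.re) (hc : 0 < c)
    (hc' : c < 2 * υ.re) {R : ℝ} (hR : 0 < R) :
    ∃ C k : ℝ, 0 < k ∧ ∀ p : ℂ, 0 ≤ p.re → R ≤ ‖p‖ → ∀ τ : ℝ,
      ‖expSqrtKernel υ s p (c + τ * Complex.I)‖ ≤ C * Real.exp (-(k * |τ|)) := by
  set δ : ℝ := Real.pi / 2 - |s.arg| with hδ
  have hδ0 : 0 < δ := by have := abs_arg_lt_of_re_pos hs; linarith
  have hδ1 : δ ≤ Real.pi / 2 := by have := abs_nonneg s.arg; linarith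
  -- The rate must beat |arg s| = π/2 - δ, which leaves a surplus 3δ/4 from Γ(u) s^(-u). As |arg p|
  -- may equal π/2, the second Gamma factor may lose (δ/4)|Im υ - τ/2|, so at most δ/8 per unit of
  -- |τ| plus a constant. What remains exceeds δ/2.
  set θ : ℝ := Real.pi / 2 - δ / 4 with hθ
  have hθ0 : 0 < θ := by linarith [Real.pi_pos]
  have hθ1 : |θ| < Real.pi / 2 := by rw [abs_of_pos hθ0]; linarith
  have hs0 : s ≠ 0 := by rintro rfl; simp at hs
  set e : ℝ := υ.re - c / 2 with he
  have he0 : 0 < e := by linarith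
  have hcos : 0 < Real.cos θ := Real.cos_pos_of_mem_Ioo (abs_lt.mp hθ1)
  refine ⟨(1 / Real.cos θ) ^ c * Real.Gamma c * ‖s‖ ^ (-c) *
    ((1 / Real.cos θ) ^ e * Real.Gamma e * R ^ (-e)) * Real.exp (δ / 4 * |υ.im|), δ / 2,
    by linarith, fun p hp hpR τ => ?_⟩
  have hp0 : p ≠ 0 := norm_pos_iff.mp (hR.trans_le hpR)
  have hure : (c + τ * Complex.I : ℂ).re = c := by simp
  have huim : (c + τ * Complex.I : ℂ).im = τ := by simp
  have hare : (υ - (c + τ * Complex.I : ℂ) / 2).re = e := by simp [he]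
  have haim : (υ - (c + τ * Complex.I : ℂ) / 2).im = υ.im - τ / 2 := by simp
  have h1 := norm_Gamma_le (a := c + τ * Complex.I) (by rwa [hure]) hθ1
  have h2 := norm_Gamma_le (a := υ - (c + τ * Complex.I) / 2) (by rwa [hare]) hθ1
  have h3 := norm_cexp_neg_mul_log (c + τ * Complex.I) hs0
  have h4 := norm_cexp_neg_mul_log (υ - (c + τ * Complex.I) / 2) hp0
  rw [hure, huim] at h1 h3
  rw [hare, haim] at h2 h4
  have h5 : ‖p‖ ^ (-e) ≤ R ^ (-e) := Real.rpow_le_rpow_of_nonpos hR hpR (by linarith)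
  have hargp : |p.arg| ≤ Real.pi / 2 := Complex.abs_arg_le_pi_div_two_iff.mpr hp
  have hG1 := Real.Gamma_pos_of_pos hc
  have hG2 := Real.Gamma_pos_of_pos he0
  rw [expSqrtKernel, norm_mul, norm_mul, norm_mul, h3, h4]
  calc _ ≤ (1 / Real.cos θ) ^ c * Real.Gamma c * Real.exp (-(|θ| * |τ|)) *
        (‖s‖ ^ (-c) * Real.exp (s.arg * τ)) *
        ((1 / Real.cos θ) ^ e * Real.Gamma e * Real.exp (-(|θ| * |υ.im - τ / 2|)) *
          (R ^ (-e) * Real.exp (p.arg * (υ.im - τ / 2)))) := by gcongr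
    _ = (1 / Real.cos θ) ^ c * Real.Gamma c * ‖s‖ ^ (-c) *
        ((1 / Real.cos θ) ^ e * Real.Gamma e * R ^ (-e)) *
        Real.exp (-(|θ| * |τ|) + s.arg * τ + (-(|θ| * |υ.im - τ / 2|) +
          p.arg * (υ.im - τ / 2))) := by
      simp only [Real.exp_add]; ring
    _ ≤ (1 / Real.cos θ) ^ c * Real.Gamma c * ‖s‖ ^ (-c) *
        ((1 / Real.cos θ) ^ e * Real.Gamma e * R ^ (-e)) *
        Real.exp (δ / 4 * |υ.im| + -(δ / 2 * |τ|)) := by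
      refine mul_le_mul_of_nonneg_left (Real.exp_le_exp.mpr ?_) (by positivity)
      have e1 : s.arg * τ ≤ |s.arg| * |τ| := by rw [← abs_mul]; exact le_abs_self _
      have e2 : p.arg * (υ.im - τ / 2) ≤ Real.pi / 2 * |υ.im - τ / 2| := by
        refine (le_abs_self _).trans ?_
        rw [abs_mul]
        gcongr
      have e3 : |υ.im - τ / 2| ≤ |υ.im| + |τ| / 2 := by
        refine (abs_sub _ _).trans_eq ?_
        rw [abs_div, abs_two]
      have e4 := mul_le_mul_of_nonneg_left e3 (by linarith : 0 ≤ δ / 4)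
      have e5 := mul_nonneg hδ0.le (abs_nonneg τ)
      rw [abs_of_pos hθ0]
      have e6 : |s.arg| = Real.pi / 2 - δ := by rw [hδ]; ring
      rw [e6] at e1
      rw [hθ]
      linarith
    _ = _ := by rw [Real.exp_add]; ring

theorem continuous_expSqrtKernel {υ s p : ℂ} {c : ℝ} (hc : 0 < c) (hc' : c < 2 * υ.re) :
    Continuous fun τ : ℝ => expSqrtKernel υ s p (c + τ * Complex.I) := by
  unfold expSqrtKernel
  have h1 := continuous_Gamma_of_re_pos (f := fun τ : ℝ => (c + τ * Complex.I : ℂ))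
    (by fun_prop) (by simpa using hc)
  have h2 := continuous_Gamma_of_re_pos (f := fun τ : ℝ => υ - (c + τ * Complex.I : ℂ) / 2)
    (by fun_prop) (by intro τ; simp; linarith)
  fun_prop

theorem integrable_expSqrtKernel {υ s p : ℂ} {c : ℝ} (hs : 0 < s.re) (hc : 0 < c)
    (hc' : c < 2 * υ.re) (hp : 0 ≤ p.re) (hp0 : p ≠ 0) :
    Integrable fun τ : ℝ => expSqrtKernel υ s p (c + τ * Complex.I) := by
  obtain ⟨C, k, hk, h⟩ := norm_expSqrtKernel_le hs hc hc' (norm_pos_iff.mpr hp0)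
  refine Integrable.mono' ((integrable_exp_neg_mul_abs hk).const_mul C)
    (continuous_expSqrtKernel hc hc').aestronglyMeasurable (.of_forall fun τ => ?_)
  exact h p hp le_rfl τ

theorem integrable_Gamma_mul_cexp_neg_mul_log {s : ℂ} {c : ℝ} (hs : 0 < s.re) (hc : 0 < c) :
    Integrable fun τ : ℝ => Complex.Gamma (c + τ * Complex.I) *
      Complex.exp (-(c + τ * Complex.I) * Complex.log s) := by
  have hs0 : s ≠ 0 := by rintro rfl; simp at hs
  set δ : ℝ := Real.pi / 2 - |s.arg| with hδ
  have hδ0 : 0 < δ := by have := abs_arg_lt_of_re_pos hs; linarith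
  have hδ1 : δ ≤ Real.pi / 2 := by have := abs_nonneg s.arg; linarith
  set θ : ℝ := Real.pi / 2 - δ / 2 with hθ
  have hθ0 : 0 < θ := by linarith [Real.pi_pos]
  have hθ1 : |θ| < Real.pi / 2 := by rw [abs_of_pos hθ0]; linarith
  have hcos : 0 < Real.cos θ := Real.cos_pos_of_mem_Ioo (abs_lt.mp hθ1)
  have hG1 := Real.Gamma_pos_of_pos hc
  refine Integrable.mono' ((integrable_exp_neg_mul_abs (half_pos hδ0)).const_mul
    ((1 / Real.cos θ) ^ c * Real.Gamma c * ‖s‖ ^ (-c))) ?_ (.of_forall fun τ => ?_)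
  · have h1 := continuous_Gamma_of_re_pos (f := fun τ : ℝ => (c + τ * Complex.I : ℂ))
      (by fun_prop) (by simpa using hc)
    exact (by fun_prop : Continuous _).aestronglyMeasurable
  · have hure : (c + τ * Complex.I : ℂ).re = c := by simp
    have huim : (c + τ * Complex.I : ℂ).im = τ := by simp
    have h1 := norm_Gamma_le (a := c + τ * Complex.I) (by rwa [hure]) hθ1
    have h3 := norm_cexp_neg_mul_log (c + τ * Complex.I) hs0
    rw [hure, huim] at h1 h3
    rw [norm_mul, h3]
    calc _ ≤ (1 / Real.cos θ) ^ c * Real.Gamma c * Real.exp (-(|θ| * |τ|)) *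
          (‖s‖ ^ (-c) * Real.exp (s.arg * τ)) := by gcongr
      _ = (1 / Real.cos θ) ^ c * Real.Gamma c * ‖s‖ ^ (-c) *
          Real.exp (-(|θ| * |τ|) + s.arg * τ) := by rw [Real.exp_add]; ring
      _ ≤ _ := by
        gcongr
        have e1 : s.arg * τ ≤ |s.arg| * |τ| := by rw [← abs_mul]; exact le_abs_self _
        have e6 : |s.arg| = Real.pi / 2 - δ := by rw [hδ]; ring
        rw [e6] at e1
        rw [abs_of_pos hθ0, hθ]
        linarith

/-- Mellin inversion for the exponential function. -/
theorem cexp_neg_mul_eq_integral {s : ℂ} {c : ℝ} (hs : 0 < s.re) (hc : 0 < c) {x : ℝ}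
    (hx : 0 < x) :
    Complex.exp (-(s * x)) = 1 / (2 * Real.pi) * ∫ τ : ℝ, (x : ℂ) ^ (-(c + τ * Complex.I)) *
      (Complex.Gamma (c + τ * Complex.I) *
        Complex.exp (-(c + τ * Complex.I) * Complex.log s)) := by
  have hm : ∀ u : ℂ, 0 < u.re → mellin (fun x : ℝ => Complex.exp (-(s * x))) u =
      Complex.Gamma u * Complex.exp (-u * Complex.log s) := fun u hu =>
    integral_cpow_mul_cexp_neg_mul hu hs
  have h := mellinInv_mellin_eq c (fun x : ℝ => Complex.exp (-(s * x))) hx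
    (integrableOn_cpow_mul_cexp_neg_mul (by simpa using hc) hs)
    ((integrable_Gamma_mul_cexp_neg_mul_log hs hc).congr (.of_forall fun τ =>
      (hm _ (by simpa using hc)).symm))
    (by fun_prop)
  rw [← h, mellinInv, Complex.real_smul]
  push_cast
  congr 2
  ext τ
  rw [hm _ (by simpa using hc), smul_eq_mul]

theorem ofReal_cpow_eq_cexp {x : ℝ} (hx : 0 < x) (w : ℂ) :
    (x : ℂ) ^ w = Complex.exp (w * Real.log x) := by
  rw [Complex.cpow_def_of_ne_zero (Complex.ofReal_ne_zero.mpr hx.ne'), Complex.ofReal_log hx.le,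
    mul_comm]

theorem cpow_mul_sqrt_cpow {x : ℝ} (hx : 0 < x) (υ u : ℂ) :
    (x : ℂ) ^ (υ - 1) * (Real.sqrt x : ℂ) ^ (-u) = (x : ℂ) ^ (υ - u / 2 - 1) := by
  rw [ofReal_cpow_eq_cexp hx, ofReal_cpow_eq_cexp (Real.sqrt_pos.mpr hx),
    ofReal_cpow_eq_cexp hx, Real.log_sqrt hx.le, ← Complex.exp_add]
  congr 1
  push_cast
  ring

/-- Fubini after Mellin inversion of exp(-s√x). Re p > 0 makes x^(Re υ - c/2 - 1) exp(-px)
absolutely integrable; the inner integral over x is then a Gamma function. -/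
theorem integral_cpow_mul_cexp_mul_cexp_sqrt {υ s p : ℂ} {c : ℝ} (hs : 0 < s.re) (hc : 0 < c)
    (hc' : c < 2 * υ.re) (hp : 0 < p.re) :
    ∫ x in Ioi (0 : ℝ), (x : ℂ) ^ (υ - 1) * Complex.exp (-(p * x)) *
        Complex.exp (-(s * Real.sqrt x)) =
      1 / (2 * Real.pi) * ∫ τ : ℝ, expSqrtKernel υ s p (c + τ * Complex.I) := by
  set G : ℝ → ℂ := fun τ => Complex.Gamma (c + τ * Complex.I) *
      Complex.exp (-(c + τ * Complex.I) * Complex.log s) with hG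
  have hGi : Integrable G := integrable_Gamma_mul_cexp_neg_mul_log hs hc
  have hre : ∀ τ : ℝ, (υ - (c + τ * Complex.I) / 2).re = υ.re - c / 2 := fun τ => by simp
  have hint : Integrable (Function.uncurry fun (x τ : ℝ) =>
      (x : ℂ) ^ (υ - (c + τ * Complex.I) / 2 - 1) * Complex.exp (-(p * x)) * G τ)
      ((volume.restrict (Ioi 0)).prod volume) := by
    refine Integrable.mono' ((integrableOn_rpow_mul_exp_neg_mul (a := υ.re - c / 2)
      (by linarith) hp).mul_prod hGi.norm) ?_ ?_
    · refine AEStronglyMeasurable.mul ?_ hGi.aestronglyMeasurable.comp_snd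
      exact (by fun_prop : Measurable fun z : ℝ × ℝ =>
        (z.1 : ℂ) ^ (υ - (c + z.2 * Complex.I) / 2 - 1) *
          Complex.exp (-(p * z.1))).aestronglyMeasurable
    · have hmem : ∀ᵐ z : ℝ × ℝ ∂(volume.restrict (Ioi (0 : ℝ))).prod volume, 0 < z.1 :=
        Measure.quasiMeasurePreserving_fst.ae (ae_restrict_mem measurableSet_Ioi)
      filter_upwards [hmem] with z hz
      rw [Function.uncurry_def, norm_mul, norm_cpow_mul_cexp_neg_mul _ _ hz, hre]
  calc _ = ∫ x in Ioi (0 : ℝ), 1 / (2 * Real.pi) * ∫ τ : ℝ,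
        (x : ℂ) ^ (υ - (c + τ * Complex.I) / 2 - 1) * Complex.exp (-(p * x)) * G τ := by
        refine setIntegral_congr_fun measurableSet_Ioi fun x hx => ?_
        rw [cexp_neg_mul_eq_integral hs hc (Real.sqrt_pos.mpr hx), mul_left_comm,
          ← integral_const_mul]
        congr 2
        ext τ
        rw [← cpow_mul_sqrt_cpow hx]
        ring
    _ = _ := by
        rw [integral_const_mul, integral_integral_swap hint]
        congr 2
        ext τ
        rw [integral_mul_const, integral_cpow_mul_cexp_neg_mul (by rw [hre]; linarith) hp,
          expSqrtKernel]
        ring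

theorem norm_cpow_mul_cexp_neg_mul_sqrt (υ s : ℂ) {x : ℝ} (hx : 0 < x) :
    ‖(x : ℂ) ^ (υ - 1) * Complex.exp (-(s * Real.sqrt x))‖ =
      x ^ (υ.re - 1) * Real.exp (-(s.re * Real.sqrt x)) := by
  rw [norm_mul, Complex.norm_cpow_eq_rpow_re_of_pos hx, Complex.norm_exp]
  simp

theorem integrableOn_rpow_mul_exp_neg_mul_sqrt {a r : ℝ} (ha : 0 < a) (hr : 0 < r) :
    IntegrableOn (fun x : ℝ => x ^ (a - 1) * Real.exp (-(r * Real.sqrt x))) (Ioi 0) := by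
  have h := integrableOn_rpow_mul_exp_neg_mul_rpow (s := a - 1) (p := 1 / 2) (by linarith)
    (by norm_num) hr
  simpa [Real.sqrt_eq_rpow] using h

theorem integral_rpow_mul_exp_neg_mul_sqrt {a r : ℝ} (ha : 0 < a) (hr : 0 < r) :
    ∫ x in Ioi (0 : ℝ), x ^ (a - 1) * Real.exp (-(r * Real.sqrt x)) =
      r ^ (-(2 * a)) * 2 * Real.Gamma (2 * a) := by
  have h := integral_rpow_mul_exp_neg_mul_rpow (q := a - 1) (p := 1 / 2) (by norm_num)
    (by linarith) hr
  rw [show -(a - 1 + 1) / (1 / 2) = -(2 * a) by ring, show (a - 1 + 1) / (1 / 2) = 2 * a by ring,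
    one_div_one_div] at h
  simpa [Real.sqrt_eq_rpow] using h

theorem integrableOn_cpow_mul_cexp_mul_cexp_sqrt {υ s p : ℂ} (hυ : 0 < υ.re) (hs : 0 < s.re)
    (hp : 0 ≤ p.re) :
    IntegrableOn (fun x : ℝ => (x : ℂ) ^ (υ - 1) * Complex.exp (-(p * x)) *
      Complex.exp (-(s * Real.sqrt x))) (Ioi 0) := by
  refine Integrable.mono' (integrableOn_rpow_mul_exp_neg_mul_sqrt hυ hs) ?_ ?_
  · exact (by fun_prop : Measurable fun x : ℝ => (x : ℂ) ^ (υ - 1) * Complex.exp (-(p * x)) *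
      Complex.exp (-(s * Real.sqrt x))).aestronglyMeasurable
  · filter_upwards [ae_restrict_mem measurableSet_Ioi] with x hx
    have hx : 0 < x := hx
    rw [mul_right_comm, norm_mul, norm_cpow_mul_cexp_neg_mul_sqrt υ s hx]
    refine mul_le_of_le_one_right (by positivity) ?_
    rw [Complex.norm_exp, Real.exp_le_one_iff]
    simpa using mul_nonneg hp hx.le

/-- The limiting case of a purely imaginary `p`. -/
theorem integral_cpow_mul_cexp_mul_I_mul_cexp_sqrt {υ s : ℂ} {c : ℝ} (hs : 0 < s.re)
    (hc : 0 < c) (hc' : c < 2 * υ.re) {y : ℝ} (hy : y ≠ 0) :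
    ∫ x in Ioi (0 : ℝ), (x : ℂ) ^ (υ - 1) * Complex.exp (-(y * Complex.I * x)) *
        Complex.exp (-(s * Real.sqrt x)) =
      1 / (2 * Real.pi) * ∫ τ : ℝ, expSqrtKernel υ s (y * Complex.I) (c + τ * Complex.I) := by
  have hυ : 0 < υ.re := by linarith
  have hpre : ∀ ε : ℝ, (ε + y * Complex.I : ℂ).re = ε := fun ε => by simp
  have hptend : Filter.Tendsto (fun ε : ℝ => (ε + y * Complex.I : ℂ)) (nhdsWithin 0 (Ioi 0))
      (nhds (y * Complex.I)) := by
    refine (Continuous.tendsto' (by fun_prop) 0 _ ?_).mono_left nhdsWithin_le_nhds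
    simp
  have hslit : (y * Complex.I : ℂ) ∈ Complex.slitPlane := Or.inr (by simpa using hy)
  have hlhs : Filter.Tendsto (fun ε : ℝ => ∫ x in Ioi (0 : ℝ), (x : ℂ) ^ (υ - 1) *
      Complex.exp (-((ε + y * Complex.I) * x)) * Complex.exp (-(s * Real.sqrt x)))
      (nhdsWithin 0 (Ioi 0)) (nhds (∫ x in Ioi (0 : ℝ), (x : ℂ) ^ (υ - 1) *
        Complex.exp (-(y * Complex.I * x)) * Complex.exp (-(s * Real.sqrt x)))) := by
    refine tendsto_integral_filter_of_dominated_convergence _ (.of_forall fun ε => ?_) ?_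
      (integrableOn_rpow_mul_exp_neg_mul_sqrt hυ hs) (.of_forall fun x => ?_)
    · exact (by fun_prop : Measurable fun x : ℝ => (x : ℂ) ^ (υ - 1) *
        Complex.exp (-((ε + y * Complex.I) * x)) *
          Complex.exp (-(s * Real.sqrt x))).aestronglyMeasurable
    · filter_upwards [self_mem_nhdsWithin] with ε hε
      filter_upwards [ae_restrict_mem measurableSet_Ioi] with x hx
      have hx : 0 < x := hx
      have hε : 0 < ε := hε
      rw [mul_right_comm, norm_mul, norm_cpow_mul_cexp_neg_mul_sqrt υ s hx]
      refine mul_le_of_le_one_right (by positivity) ?_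
      rw [Complex.norm_exp, Real.exp_le_one_iff]
      simpa using mul_nonneg hε.le hx.le
    · exact ((hptend.mul_const _).neg.cexp.const_mul _).mul_const _
  -- Every p = ε + iy has norm at least |y|, so one bound serves for all ε > 0.
  obtain ⟨C, k, hk, hbound⟩ := norm_expSqrtKernel_le hs hc hc' (abs_pos.mpr hy)
  have hrhs : Filter.Tendsto (fun ε : ℝ => ∫ τ : ℝ,
      expSqrtKernel υ s (ε + y * Complex.I) (c + τ * Complex.I)) (nhdsWithin 0 (Ioi 0))
      (nhds (∫ τ : ℝ, expSqrtKernel υ s (y * Complex.I) (c + τ * Complex.I))) := by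
    refine tendsto_integral_filter_of_dominated_convergence _
      (.of_forall fun ε => (continuous_expSqrtKernel hc hc').aestronglyMeasurable) ?_
      ((integrable_exp_neg_mul_abs hk).const_mul C) (.of_forall fun τ => ?_)
    · filter_upwards [self_mem_nhdsWithin] with ε hε
      refine .of_forall fun τ => hbound _ ?_ ?_ τ
      · rw [hpre]; exact (mem_Ioi.mp hε).le
      · refine le_trans (le_of_eq ?_) (Complex.abs_im_le_norm _)
        simp
    · exact (((hptend.clog hslit).const_mul _).cexp.const_mul _).const_mul _
  refine tendsto_nhds_unique hlhs ((hrhs.const_mul (1 / (2 * Real.pi : ℂ))).congr' ?_)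
  filter_upwards [self_mem_nhdsWithin] with ε hε
  exact (integral_cpow_mul_cexp_mul_cexp_sqrt hs hc hc' (by rw [hpre]; exact hε)).symm

/-! ### From imaginary exponentials to the cosine. -/

theorem log_ofReal_mul_I {y : ℝ} (hy : 0 < y) :
    Complex.log (y * Complex.I) = Real.log y + Real.pi / 2 * Complex.I := by
  rw [Complex.log_ofReal_mul hy Complex.I_ne_zero, Complex.log_I]

theorem log_neg_ofReal_mul_I {y : ℝ} (hy : 0 < y) :
    Complex.log ((-y : ℝ) * Complex.I) = Real.log y - Real.pi / 2 * Complex.I := by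
  rw [show ((-y : ℝ) * Complex.I : ℂ) = y * -Complex.I by push_cast; ring,
    Complex.log_ofReal_mul hy (neg_ne_zero.mpr Complex.I_ne_zero), Complex.log_neg_I]
  ring

/-- As log(±iy) = log y ± iπ/2, the powers (±iy)^(-a) differ from y^(-a) by exp(∓iπa/2), and these
two phases add up to 2 cos(πa/2). -/
theorem expSqrtKernel_add {υ s u : ℂ} {y : ℝ} (hy : 0 < y) :
    expSqrtKernel υ s (y * Complex.I) u + expSqrtKernel υ s ((-y : ℝ) * Complex.I) u =
      2 * (Complex.Gamma u * Complex.exp (-u * Complex.log s) *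
        (Complex.Gamma (υ - u / 2) * Complex.exp (-(υ - u / 2) * Real.log y) *
          Complex.cos (Real.pi * (υ - u / 2) / 2))) := by
  rw [expSqrtKernel, expSqrtKernel, log_ofReal_mul_I hy, log_neg_ofReal_mul_I hy, Complex.cos,
    mul_add, mul_sub, Complex.exp_add, Complex.exp_sub,
    show -(υ - u / 2) * (Real.pi / 2 * Complex.I) =
      -(Real.pi * (υ - u / 2) / 2) * Complex.I by ring,
    div_eq_mul_inv (Complex.exp (-(υ - u / 2) * Real.log y)), ← Complex.exp_neg,
    show -(-(Real.pi * (υ - u / 2) / 2) * Complex.I) = Real.pi * (υ - u / 2) / 2 * Complex.I by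
      ring]
  ring

theorem cos_mul_eq_cexp_add (y x : ℝ) :
    (Real.cos (x * y) : ℂ) = (Complex.exp (-(y * Complex.I * x)) +
      Complex.exp (-((-y : ℝ) * Complex.I * x))) / 2 := by
  rw [Complex.ofReal_cos, Complex.cos, add_comm]
  push_cast
  congr 3 <;> ring

/-- Mellin–Barnes representation of the Laplace type integral with the cosine. -/
theorem integral_cpow_mul_cos_mul_cexp_sqrt {υ s : ℂ} {c y : ℝ} (hs : 0 < s.re)
    (hc : 0 < c) (hc' : c < 2 * υ.re) (hy : 0 < y) :
    Integrable (fun τ : ℝ => Complex.Gamma (c + τ * Complex.I) *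
      Complex.exp (-(c + τ * Complex.I) * Complex.log s) *
        (Complex.Gamma (υ - (c + τ * Complex.I) / 2) *
          Complex.exp (-(υ - (c + τ * Complex.I) / 2) * Real.log y) *
          Complex.cos (Real.pi * (υ - (c + τ * Complex.I) / 2) / 2))) ∧
    ∫ x in Ioi (0 : ℝ), (x : ℂ) ^ (υ - 1) * (Real.cos (x * y) : ℂ) *
        Complex.exp (-(s * Real.sqrt x)) =
      1 / (2 * Real.pi) * ∫ τ : ℝ, Complex.Gamma (c + τ * Complex.I) *
        Complex.exp (-(c + τ * Complex.I) * Complex.log s) *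
        (Complex.Gamma (υ - (c + τ * Complex.I) / 2) *
          Complex.exp (-(υ - (c + τ * Complex.I) / 2) * Real.log y) *
          Complex.cos (Real.pi * (υ - (c + τ * Complex.I) / 2) / 2)) := by
  have hυ : 0 < υ.re := by linarith
  have hyI : (y * Complex.I : ℂ) ≠ 0 := by simp [hy.ne']
  have hyI' : ((-y : ℝ) * Complex.I : ℂ) ≠ 0 := by simp [hy.ne']
  have hk1 := integrable_expSqrtKernel (p := y * Complex.I) hs hc hc' (by simp) hyI
  have hk2 := integrable_expSqrtKernel (p := (-y : ℝ) * Complex.I) hs hc hc' (by simp) hyI'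
  have hsum := fun τ : ℝ => expSqrtKernel_add (υ := υ) (s := s) (u := c + τ * Complex.I) hy
  constructor
  · refine ((hk1.add hk2).const_mul (1 / 2)).congr (.of_forall fun τ => ?_)
    simp only [Pi.add_apply]
    rw [hsum]
    ring
  · have h1 := integral_cpow_mul_cexp_mul_I_mul_cexp_sqrt hs hc hc' hy.ne'
    have h2 := integral_cpow_mul_cexp_mul_I_mul_cexp_sqrt hs hc hc' (neg_ne_zero.mpr hy.ne')
    have i1 := integrableOn_cpow_mul_cexp_mul_cexp_sqrt (p := y * Complex.I) hυ hs (by simp)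
    have i2 := integrableOn_cpow_mul_cexp_mul_cexp_sqrt (p := (-y : ℝ) * Complex.I) hυ hs (by simp)
    have h3 := integral_add i1 i2
    rw [h1, h2, ← mul_add, ← integral_add hk1 hk2] at h3
    simp only [hsum, integral_const_mul] at h3
    rw [mul_left_comm] at h3
    rw [← mul_right_inj' (two_ne_zero' ℂ), ← h3, ← integral_const_mul]
    refine setIntegral_congr_fun measurableSet_Ioi fun x _ => ?_
    rw [cos_mul_eq_cexp_add]
    ring

/-! ### Shifting the parameters of a Meijer G-function -/

theorem meijerGKernel_add_const {p q : ℕ} (m n : ℕ) (α : Fin p → ℂ) (β : Fin q → ℂ) (δ ζ : ℂ) :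
    meijerGKernel m n (fun j => α j + δ) (fun j => β j + δ) ζ =
      meijerGKernel m n α β (ζ - δ) := by
  unfold meijerGKernel
  congr! 4 <;> ring

theorem MeijerGSeparates.add_const_iff {p q : ℕ} {m n : ℕ} {α : Fin p → ℂ} {β : Fin q → ℂ}
    {σ : ℝ} (δ : ℝ) :
    MeijerGSeparates m n (fun j => α j + δ) (fun j => β j + δ) σ ↔
      MeijerGSeparates m n α β (σ - δ) := by
  unfold MeijerGSeparates
  refine and_congr (forall₃_congr fun j _ N => ?_) (forall₃_congr fun j _ N => ?_) <;>
  · simp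
    constructor <;> intro h <;> linarith

/-- Translate the contour: ζ = ζ' + δ restores the old kernel and splits off z^δ. For real δ
vertical lines and their parametrization by τ are preserved. -/
theorem HasMeijerG.add_const {p q : ℕ} {m n : ℕ} {α α' : Fin p → ℂ} {β β' : Fin q → ℂ}
    {w g : ℂ} (h : HasMeijerG m n α β w g) (δ : ℝ) (hα : ∀ j, α' j = α j + δ)
    (hβ : ∀ j, β' j = β j + δ) : HasMeijerG m n α' β' w (Complex.exp (δ * w) * g) := by
  obtain rfl : α' = fun j => α j + δ := funext hα
  obtain rfl : β' = fun j => β j + δ := funext hβ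
  obtain ⟨⟨σ₀, hσ₀⟩, h⟩ := h
  refine ⟨⟨σ₀ + δ, (MeijerGSeparates.add_const_iff δ).mpr (by simpa using hσ₀)⟩, fun σ hσ => ?_⟩
  obtain ⟨hi, hg⟩ := h (σ - δ) ((MeijerGSeparates.add_const_iff δ).mp hσ)
  have hker : ∀ τ : ℝ, meijerGKernel m n (fun j => α j + δ) (fun j => β j + δ)
      (σ + τ * Complex.I) * Complex.exp ((σ + τ * Complex.I) * w) =
      Complex.exp (δ * w) * (meijerGKernel m n α β ((σ - δ : ℝ) + τ * Complex.I) *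
        Complex.exp (((σ - δ : ℝ) + τ * Complex.I) * w)) := fun τ => by
    rw [meijerGKernel_add_const, mul_left_comm, ← Complex.exp_add]
    push_cast
    congr 2 <;> ring
  simp only [hker]
  refine ⟨hi.const_mul _, ?_⟩
  simp only [mul_assoc (Complex.exp (δ * w))]
  rw [integral_const_mul, mul_left_comm, hg]

/-! ### The G-functions with one upper family of four or eight parameters -/

theorem meijerGKernel_one_four (α : Fin 4 → ℂ) (β : Fin 2 → ℂ) (ζ : ℂ) :
    meijerGKernel 1 4 α β ζ = Complex.Gamma (β 0 - ζ) *
      (Complex.Gamma (1 - α 0 + ζ) * Complex.Gamma (1 - α 1 + ζ) * Complex.Gamma (1 - α 2 + ζ) *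
        Complex.Gamma (1 - α 3 + ζ)) / Complex.Gamma (1 - β 1 + ζ) := by
  simp [meijerGKernel, Finset.prod_filter, Fin.prod_univ_succ, mul_assoc]

theorem meijerGKernel_two_eight (α : Fin 8 → ℂ) (β : Fin 4 → ℂ) (ζ : ℂ) :
    meijerGKernel 2 8 α β ζ = Complex.Gamma (β 0 - ζ) * Complex.Gamma (β 1 - ζ) *
      (Complex.Gamma (1 - α 0 + ζ) * Complex.Gamma (1 - α 1 + ζ) * Complex.Gamma (1 - α 2 + ζ) *
        Complex.Gamma (1 - α 3 + ζ) * Complex.Gamma (1 - α 4 + ζ) * Complex.Gamma (1 - α 5 + ζ) *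
        Complex.Gamma (1 - α 6 + ζ) * Complex.Gamma (1 - α 7 + ζ)) /
      (Complex.Gamma (1 - β 2 + ζ) * Complex.Gamma (1 - β 3 + ζ)) := by
  simp [meijerGKernel, Finset.prod_filter, Fin.prod_univ_four, Fin.prod_univ_eight]

/-- Only the extreme poles matter: 0 on the right, and -υ/2, coming from the first upper parameter,
on the left. -/
theorem meijerGSeparates_one_four_iff {υ : ℂ} {σ : ℝ} :
    MeijerGSeparates 1 4
      ![(4 - 2 * υ) / 4, (3 - 2 * υ) / 4, (2 - 2 * υ) / 4, (1 - 2 * υ) / 4] ![0, 1 / 2] σ ↔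
      -υ.re / 2 < σ ∧ σ < 0 := by
  constructor
  · rintro ⟨h1, h2⟩
    have h1 := h1 0 (by simp) 0
    have h2 := h2 0 (by simp) 0
    simp at h1 h2
    exact ⟨by linarith, h1⟩
  · rintro ⟨h1, h2⟩
    constructor
    · intro j hj N
      have hN : (0 : ℝ) ≤ N := Nat.cast_nonneg N
      fin_cases j <;> simp at hj ⊢
      linarith
    · intro j hj N
      have hN : (0 : ℝ) ≤ N := Nat.cast_nonneg N
      fin_cases j <;> simp <;> linarith

theorem meijerGSeparates_two_eight_iff {υ : ℂ} {σ : ℝ} :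
    MeijerGSeparates 2 8
      ![(8 - 2 * υ) / 8, (7 - 2 * υ) / 8, (6 - 2 * υ) / 8, (5 - 2 * υ) / 8,
        (4 - 2 * υ) / 8, (3 - 2 * υ) / 8, (2 - 2 * υ) / 8, (1 - 2 * υ) / 8]
      ![0, 1 / 2, 1 / 4, 3 / 4] σ ↔
      -υ.re / 4 < σ ∧ σ < 0 := by
  constructor
  · rintro ⟨h1, h2⟩
    have h1 := h1 0 (by simp) 0
    have h2 := h2 0 (by simp) 0
    simp at h1 h2
    exact ⟨by linarith, h1⟩
  · rintro ⟨h1, h2⟩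
    constructor
    · intro j hj N
      have hN : (0 : ℝ) ≤ N := Nat.cast_nonneg N
      fin_cases j <;> simp at hj ⊢ <;> linarith
    · intro j hj N
      have hN : (0 : ℝ) ≤ N := Nat.cast_nonneg N
      fin_cases j <;> simp <;> linarith

/-! ### Duplication, multiplication and reflection of Gamma factors. -/

theorem two_cpow_eq_cexp (z : ℂ) : (2 : ℂ) ^ z = Complex.exp (z * Real.log 2) := by
  simpa using ofReal_cpow_eq_cexp two_pos z

theorem ofReal_sqrt_pi_mul_self : (Real.sqrt Real.pi : ℂ) * Real.sqrt Real.pi = Real.pi := by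
  rw [← Complex.ofReal_mul, Real.mul_self_sqrt Real.pi_pos.le]

theorem Gamma_mul_Gamma_add_half_eq_cexp (z : ℂ) :
    Complex.Gamma z * Complex.Gamma (z + 1 / 2) =
      Complex.Gamma (2 * z) * Complex.exp ((1 - 2 * z) * Real.log 2) * Real.sqrt Real.pi := by
  rw [Complex.Gamma_mul_Gamma_add_half, two_cpow_eq_cexp]

/-- Gauss's multiplication formula for four factors. -/
theorem Gamma_multiplication_four (z : ℂ) :
    Complex.Gamma z * Complex.Gamma (z + 1 / 4) * Complex.Gamma (z + 1 / 2) *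
      Complex.Gamma (z + 3 / 4) =
      Complex.Gamma (4 * z) * Complex.exp ((5 / 2 - 8 * z) * Real.log 2) * Real.pi *
        Real.sqrt Real.pi := by
  have h1 := Gamma_mul_Gamma_add_half_eq_cexp z
  have h2 := Gamma_mul_Gamma_add_half_eq_cexp (z + 1 / 4)
  have h3 := Gamma_mul_Gamma_add_half_eq_cexp (2 * z)
  rw [show z + 1 / 4 + 1 / 2 = z + 3 / 4 by ring,
    show 2 * (z + 1 / 4) = 2 * z + 1 / 2 by ring] at h2
  rw [show 2 * (2 * z) = 4 * z by ring] at h3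
  have he : Complex.exp ((5 / 2 - 8 * z) * Real.log 2) =
      Complex.exp ((1 - 2 * z) * Real.log 2) * Complex.exp ((1 - (2 * z + 1 / 2)) * Real.log 2) *
        Complex.exp ((1 - 4 * z) * Real.log 2) := by
    rw [← Complex.exp_add, ← Complex.exp_add]
    congr 1
    ring
  rw [he, ← ofReal_sqrt_pi_mul_self]
  linear_combination (Complex.Gamma (z + 1 / 4) * Complex.Gamma (z + 3 / 4)) * h1 +
    (Complex.Gamma (2 * z) * Complex.exp ((1 - 2 * z) * Real.log 2) * Real.sqrt Real.pi) * h2 +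
    (Complex.exp ((1 - 2 * z) * Real.log 2) * Real.sqrt Real.pi *
      Complex.exp ((1 - (2 * z + 1 / 2)) * Real.log 2) * Real.sqrt Real.pi) * h3

/-- The Gamma quotient in the Mellin transform of the cosine. -/
theorem Gamma_neg_div_Gamma_half_add {ζ : ℂ} (hζ : ζ.re < 0) :
    Complex.Gamma (-ζ) / Complex.Gamma (1 / 2 + ζ) * (Real.sqrt Real.pi) =
      Complex.Gamma (-2 * ζ) * Complex.exp ((1 + 2 * ζ) * Real.log 2) *
        Complex.cos (Real.pi * ζ) := by
  have h1 := Gamma_mul_Gamma_add_half_eq_cexp (-ζ)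
  have h2 := Complex.Gamma_mul_Gamma_one_sub (1 / 2 + ζ)
  rw [show 1 - (1 / 2 + ζ) = -ζ + 1 / 2 by ring,
    show (Real.pi * (1 / 2 + ζ) : ℂ) = Real.pi * ζ + Real.pi / 2 by ring,
    Complex.sin_add_pi_div_two] at h2
  rw [show 1 - 2 * -ζ = 1 + 2 * ζ by ring, show 2 * -ζ = -2 * ζ by ring] at h1
  have h0 : Complex.Gamma (-ζ + 1 / 2) ≠ 0 := Complex.Gamma_ne_zero_of_re_pos (by simp; linarith)
  have hpi : (Real.pi : ℂ) ≠ 0 := Complex.ofReal_ne_zero.mpr Real.pi_pos.ne'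
  -- Reflection in inverted form. It also holds at the poles of Γ(1/2 + ζ): there `Complex.Gamma`
  -- has the value 0, its inverse is 0, and the cosine vanishes.
  have h3 : (Complex.Gamma (1 / 2 + ζ))⁻¹ =
      Complex.Gamma (-ζ + 1 / 2) * Complex.cos (Real.pi * ζ) / Real.pi := by
    have h4 := congrArg Inv.inv h2
    rw [mul_inv, inv_div] at h4
    rw [mul_div_assoc, ← h4, mul_comm, mul_assoc, inv_mul_cancel₀ h0, mul_one]
  have h5 : (Real.sqrt Real.pi : ℂ) * Real.sqrt Real.pi * (Real.pi : ℂ)⁻¹ = 1 := by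
    rw [ofReal_sqrt_pi_mul_self, mul_inv_cancel₀ hpi]
  rw [div_eq_mul_inv, h3]
  linear_combination Complex.cos (Real.pi * ζ) * Real.sqrt Real.pi * (Real.pi : ℂ)⁻¹ * h1 +
    Complex.Gamma (-2 * ζ) * Complex.exp ((1 + 2 * ζ) * Real.log 2) *
      Complex.cos (Real.pi * ζ) * h5

theorem logDivPow_sq {y : ℝ} (hy : 0 < y) (s : ℂ) :
    logDivPow (64 * y ^ 2) s 4 = 6 * Real.log 2 + 2 * Real.log y - 4 * Complex.log s := by
  rw [logDivPow, Real.log_mul (by norm_num) (by positivity), Real.log_pow,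
    show (64 : ℝ) = 2 ^ 6 by norm_num, Real.log_pow]
  push_cast
  ring

/-- The relation 4^8 y^4/s^8 = 2^4 (64 y^2/s^4)^2, kept at the level of logarithms so that no branch
is lost. -/
theorem logDivPow_pow_four {y : ℝ} (hy : 0 < y) (s : ℂ) :
    logDivPow (4 ^ 8 * y ^ 4) s 8 = 2 * logDivPow (64 * y ^ 2) s 4 + 4 * Real.log 2 := by
  rw [logDivPow_sq hy, logDivPow, Real.log_mul (by norm_num) (by positivity), Real.log_pow,
    Real.log_pow, show (4 : ℝ) = 2 ^ 2 by norm_num, Real.log_pow]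
  push_cast
  ring

/-- The Mellin–Barnes integrand of the first G-function in terms of the kernel of the
Laplace type integral. -/
theorem meijerGKernel_one_four_mul_cexp {υ s ζ : ℂ} {y : ℝ} (hy : 0 < y) (hζ : ζ.re < 0) :
    meijerGKernel 1 4
      ![(4 - 2 * υ) / 4, (3 - 2 * υ) / 4, (2 - 2 * υ) / 4, (1 - 2 * υ) / 4] ![0, 1 / 2] ζ *
      Complex.exp (ζ * logDivPow (64 * y ^ 2) s 4) =
    Real.pi * Complex.exp ((7 / 2 - 4 * υ) * Real.log 2 + 2 * υ * Complex.log s) *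
      (Complex.Gamma (2 * υ + 4 * ζ) * Complex.exp (-(2 * υ + 4 * ζ) * Complex.log s) *
        (Complex.Gamma (υ - (2 * υ + 4 * ζ) / 2) *
          Complex.exp (-(υ - (2 * υ + 4 * ζ) / 2) * Real.log y) *
          Complex.cos (Real.pi * (υ - (2 * υ + 4 * ζ) / 2) / 2))) := by
  have h1 := Gamma_multiplication_four (υ / 2 + ζ)
  have h2 := Gamma_neg_div_Gamma_half_add hζ
  rw [meijerGKernel_one_four, logDivPow_sq hy]
  simp only [Matrix.cons_val]
  rw [show υ - (2 * υ + 4 * ζ) / 2 = -2 * ζ by ring,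
    show Real.pi * (-2 * ζ) / 2 = -(Real.pi * ζ) by ring, Complex.cos_neg,
    show 1 - (4 - 2 * υ) / 4 + ζ = υ / 2 + ζ by ring,
    show 1 - (3 - 2 * υ) / 4 + ζ = υ / 2 + ζ + 1 / 4 by ring,
    show 1 - (2 - 2 * υ) / 4 + ζ = υ / 2 + ζ + 1 / 2 by ring,
    show 1 - (1 - 2 * υ) / 4 + ζ = υ / 2 + ζ + 3 / 4 by ring,
    show (1 : ℂ) - 1 / 2 + ζ = 1 / 2 + ζ by ring, zero_sub, h1,
    show 4 * (υ / 2 + ζ) = 2 * υ + 4 * ζ by ring]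
  have he : Complex.exp ((7 / 2 - 4 * υ) * Real.log 2 + 2 * υ * Complex.log s) *
      Complex.exp (-(2 * υ + 4 * ζ) * Complex.log s) * Complex.exp (-(-2 * ζ) * Real.log y) =
      Complex.exp ((5 / 2 - 8 * (υ / 2 + ζ)) * Real.log 2) *
      Complex.exp ((1 + 2 * ζ) * Real.log 2) *
      Complex.exp (ζ * (6 * Real.log 2 + 2 * Real.log y - 4 * Complex.log s)) := by
    simp only [← Complex.exp_add]
    congr 1
    ring
  linear_combination (Complex.Gamma (2 * υ + 4 * ζ) *
    Complex.exp ((5 / 2 - 8 * (υ / 2 + ζ)) * Real.log 2) * Real.pi *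
    Complex.exp (ζ * (6 * Real.log 2 + 2 * Real.log y - 4 * Complex.log s))) * h2 -
    Real.pi * Complex.Gamma (2 * υ + 4 * ζ) * Complex.Gamma (-2 * ζ) *
      Complex.cos (Real.pi * ζ) * he

/-- The Laplace type integral `∫ x ^ (υ - 1) cos (x y) exp (- s √x) dx`. -/
noncomputable def cosLaplaceSqrt (υ s : ℂ) (y : ℝ) : ℂ :=
  ∫ x in Ioi (0 : ℝ), (x : ℂ) ^ (υ - 1) * (Real.cos (x * y) : ℂ) *
    Complex.exp (-(s * Real.sqrt x))

theorem hasMeijerG_one_four {υ s : ℂ} {y : ℝ} (hυ : 0 < υ.re) (hs : 0 < s.re) (hy : 0 < y) :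
    HasMeijerG 1 4
      ![(4 - 2 * υ) / 4, (3 - 2 * υ) / 4, (2 - 2 * υ) / 4, (1 - 2 * υ) / 4] ![0, 1 / 2]
      (logDivPow (64 * y ^ 2) s 4)
      (Real.pi * Complex.exp ((3 / 2 - 4 * υ) * Real.log 2 + 2 * υ * Complex.log s) *
        cosLaplaceSqrt υ s y) := by
  refine ⟨⟨-υ.re / 4, meijerGSeparates_one_four_iff.mpr ⟨by linarith, by linarith⟩⟩,
    fun σ hσ => ?_⟩
  obtain ⟨hσ1, hσ2⟩ := meijerGSeparates_one_four_iff.mp hσ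
  -- Under u = 2υ + 4ζ the line Re ζ = σ becomes Re u = c, and the separation condition -Re υ/2 < σ
  -- < 0 becomes exactly 0 < c < 2 Re υ.
  obtain ⟨hi, hJ⟩ := integral_cpow_mul_cos_mul_cexp_sqrt (υ := υ) (c := 2 * υ.re + 4 * σ) hs
    (by linarith) (by linarith) hy
  set K : ℝ → ℂ := fun τ => Complex.Gamma ((2 * υ.re + 4 * σ : ℝ) + τ * Complex.I) *
      Complex.exp (-((2 * υ.re + 4 * σ : ℝ) + τ * Complex.I) * Complex.log s) *
        (Complex.Gamma (υ - ((2 * υ.re + 4 * σ : ℝ) + τ * Complex.I) / 2) *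
          Complex.exp (-(υ - ((2 * υ.re + 4 * σ : ℝ) + τ * Complex.I) / 2) * Real.log y) *
          Complex.cos (Real.pi * (υ - ((2 * υ.re + 4 * σ : ℝ) + τ * Complex.I) / 2) / 2)) with hK
  have hker : ∀ τ : ℝ, meijerGKernel 1 4
      ![(4 - 2 * υ) / 4, (3 - 2 * υ) / 4, (2 - 2 * υ) / 4, (1 - 2 * υ) / 4] ![0, 1 / 2]
      (σ + τ * Complex.I) * Complex.exp ((σ + τ * Complex.I) * logDivPow (64 * y ^ 2) s 4) =
      Real.pi * Complex.exp ((7 / 2 - 4 * υ) * Real.log 2 + 2 * υ * Complex.log s) *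
        K (4 * τ + 2 * υ.im) := fun τ => by
    have hu : 2 * υ + 4 * (σ + τ * Complex.I) =
        (2 * υ.re + 4 * σ : ℝ) + (4 * τ + 2 * υ.im : ℝ) * Complex.I := by
      nth_rewrite 1 [← Complex.re_add_im υ]
      push_cast
      ring
    rw [meijerGKernel_one_four_mul_cexp hy (by simpa using hσ2), hu]
  have hKi : Integrable fun τ : ℝ => K (4 * τ + 2 * υ.im) :=
    (hi.comp_add_right (2 * υ.im)).comp_mul_left' four_ne_zero
  have hKint : ∫ τ : ℝ, K (4 * τ + 2 * υ.im) = 1 / 4 * ∫ τ : ℝ, K τ := by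
    rw [Measure.integral_comp_mul_left (fun τ => K (τ + 2 * υ.im)),
      integral_add_right_eq_self (fun τ => K τ), Complex.real_smul, abs_of_pos (by norm_num)]
    push_cast
    ring
  simp only [hker]
  refine ⟨hKi.const_mul _, ?_⟩
  rw [integral_mul_const, integral_const_mul, hKint, cosLaplaceSqrt, hJ]
  have he : Complex.exp ((7 / 2 - 4 * υ) * Real.log 2 + 2 * υ * Complex.log s) =
      4 * Complex.exp ((3 / 2 - 4 * υ) * Real.log 2 + 2 * υ * Complex.log s) := by
    rw [show (7 / 2 - 4 * υ) * Real.log 2 + 2 * υ * Complex.log s = 2 * Real.log 2 +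
      ((3 / 2 - 4 * υ) * Real.log 2 + 2 * υ * Complex.log s) by ring, Complex.exp_add,
      ← two_cpow_eq_cexp]
    norm_num
  rw [he]
  have hpi : (Real.pi : ℂ) ≠ 0 := Complex.ofReal_ne_zero.mpr Real.pi_pos.ne'
  field_simp

/-! ### The binomial series and termwise integration -/

theorem pochhammerCoeff_eq_choose (lam : ℂ) (k : ℕ) :
    pochhammerCoeff lam k = Ring.choose (lam + k - 1) k := by
  rw [← Ring.multichoose_eq, pochhammerCoeff, div_eq_iff (by exact_mod_cast k.factorial_ne_zero),
    ← Polynomial.ascPochhammer_smeval_eq_eval, ← Ring.factorial_nsmul_multichoose_eq_ascPochhammer,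
    nsmul_eq_mul, mul_comm]

theorem hasSum_pochhammerCoeff_mul_pow (lam : ℂ) {q : ℂ} (hq : ‖q‖ < 1) :
    HasSum (fun k => pochhammerCoeff lam k * q ^ k) (1 / (1 - q) ^ lam) := by
  have h := (Complex.one_div_one_sub_cpow_hasFPowerSeriesOnBall_zero lam).hasSum (y := q) (by
    rw [← ENNReal.ofReal_one, Metric.eball_ofReal]
    simpa using hq)
  simpa [FormalMultilinearSeries.ofScalars_apply_eq, pochhammerCoeff_eq_choose, mul_comm] using h

theorem ascPochhammer_eval_eq_prod (lam : ℂ) (k : ℕ) :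
    (ascPochhammer ℂ k).eval lam = ∏ j ∈ Finset.range k, (lam + j) := by
  induction k with
  | zero => simp
  | succ k ih => rw [ascPochhammer_succ_eval, ih, Finset.prod_range_succ]

/-- Euler's product for Γ(lam) has the Pochhammer product as denominator, so its limit yields the
growth k^(Re lam - 1) of the coefficients. -/
theorem pochhammerCoeff_succ_mul_GammaSeq {lam : ℂ} (hlam : 0 < lam.re) (n : ℕ) :
    pochhammerCoeff lam (n + 1) * Complex.GammaSeq lam n = (n : ℂ) ^ lam / (n + 1) := by
  have h0 : ∏ j ∈ Finset.range (n + 1), (lam + j) ≠ 0 := by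
    refine Finset.prod_ne_zero_iff.mpr fun j _ h => ?_
    have := congrArg Complex.re h
    simp at this
    linarith [(Nat.cast_nonneg j : (0 : ℝ) ≤ j)]
  have h1 : (n.factorial : ℂ) ≠ 0 := by exact_mod_cast n.factorial_ne_zero
  have h2 : (n + 1 : ℂ) ≠ 0 := by exact_mod_cast n.succ_ne_zero
  rw [pochhammerCoeff, ascPochhammer_eval_eq_prod, Complex.GammaSeq, Nat.factorial_succ]
  push_cast
  field_simp

theorem eventually_norm_pochhammerCoeff_succ_le {lam : ℂ} (hlam : 0 < lam.re) :
    ∃ C : ℝ, 0 ≤ C ∧ ∀ᶠ n : ℕ in Filter.atTop,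
      ‖pochhammerCoeff lam (n + 1)‖ ≤ C * (n : ℝ) ^ (lam.re - 1) := by
  have hG : 0 < ‖Complex.Gamma lam‖ := norm_pos_iff.mpr (Complex.Gamma_ne_zero_of_re_pos hlam)
  refine ⟨2 / ‖Complex.Gamma lam‖, by positivity, ?_⟩
  filter_upwards [(Complex.GammaSeq_tendsto_Gamma lam).norm.eventually_const_lt
    (half_lt_self hG), Filter.eventually_gt_atTop 0] with n hn hn0
  have hn0' : (0 : ℝ) < n := Nat.cast_pos.mpr hn0
  have h := congrArg norm (pochhammerCoeff_succ_mul_GammaSeq hlam n)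
  rw [norm_mul, norm_div, Complex.norm_natCast_cpow_of_pos hn0,
    show ((n : ℂ) + 1) = ((n + 1 : ℕ) : ℂ) by push_cast; rfl, Complex.norm_natCast] at h
  have h2 : (n : ℝ) ^ lam.re / ((n + 1 : ℕ) : ℝ) ≤ (n : ℝ) ^ (lam.re - 1) := by
    rw [Real.rpow_sub_one hn0'.ne']
    push_cast
    gcongr
    linarith
  have h3 : ‖pochhammerCoeff lam (n + 1)‖ * (‖Complex.Gamma lam‖ / 2) ≤
      (n : ℝ) ^ (lam.re - 1) := by
    refine le_trans ?_ (h.trans_le h2)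
    gcongr
  rw [div_mul_eq_mul_div, le_div_iff₀ hG]
  linarith

theorem summable_norm_pochhammerCoeff_mul_rpow {lam : ℂ} {a d e : ℝ} (hlam : 0 < lam.re)
    (ha : 0 < a) (hd : 0 < d) (he : lam.re < e) :
    Summable fun k : ℕ => ‖pochhammerCoeff lam k‖ * (a + d * k) ^ (-e) := by
  obtain ⟨C, hC, h⟩ := eventually_norm_pochhammerCoeff_succ_le hlam
  rw [← summable_nat_add_iff 1]
  refine Summable.of_norm_bounded_eventually_nat
    (g := fun n : ℕ => C * d ^ (-e) * (n : ℝ) ^ (lam.re - 1 - e))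
    ((Real.summable_nat_rpow.mpr (by linarith)).mul_left _) ?_
  filter_upwards [h, Filter.eventually_gt_atTop 0] with n hn hn0
  have hn0' : (0 : ℝ) < n := Nat.cast_pos.mpr hn0
  have h1 : (a + d * ((n + 1 : ℕ) : ℝ)) ^ (-e) ≤ (d * n) ^ (-e) := by
    refine Real.rpow_le_rpow_of_nonpos (by positivity) ?_ (by linarith)
    push_cast
    nlinarith
  rw [norm_mul, norm_norm, Real.norm_of_nonneg (by positivity)]
  calc _ ≤ C * (n : ℝ) ^ (lam.re - 1) * (d * n) ^ (-e) := by gcongr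
    _ = _ := by
      rw [Real.mul_rpow hd.le hn0'.le, sub_eq_add_neg _ e, Real.rpow_add hn0']
      ring

/-- Summability of the integrals of norms gives integrability of the sum as well, so the convergence
of the original integral comes with the termwise formula. -/
theorem integrable_and_hasSum_integral {α : Type*} [MeasurableSpace α] {μ : Measure α}
    {F : ℕ → α → ℂ} {f : α → ℂ} (hF : ∀ n, Integrable (F n) μ)
    (hsum : Summable fun n => ∫ x, ‖F n x‖ ∂μ) (hf : AEStronglyMeasurable f μ)
    (h : ∀ᵐ x ∂μ, HasSum (fun n => F n x) (f x)) :
    Integrable f μ ∧ HasSum (fun n => ∫ x, F n x ∂μ) (∫ x, f x ∂μ) := by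
  constructor
  · refine ⟨hf, ?_⟩
    calc ∫⁻ x, ‖f x‖ₑ ∂μ ≤ ∫⁻ x, ∑' n, ‖F n x‖ₑ ∂μ := by
          refine lintegral_mono_ae ?_
          filter_upwards [h] with x hx
          rw [← hx.tsum_eq]
          exact enorm_tsum_le_tsum_enorm
      _ = ∑' n, ENNReal.ofReal (∫ x, ‖F n x‖ ∂μ) := by
          rw [lintegral_tsum fun n => (hF n).1.enorm]
          simp only [ofReal_integral_norm_eq_lintegral_enorm (hF _)]
      _ < ⊤ := by
          rw [← ENNReal.ofReal_tsum_of_nonneg (fun n => integral_nonneg fun _ => norm_nonneg _) hsum]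
          exact ENNReal.ofReal_lt_top
  · have h1 := hasSum_integral_of_summable_integral_norm hF hsum
    rwa [integral_congr_ae (h.mono fun x hx => hx.tsum_eq)] at h1

/-- The chosen logarithm is b√x plus the principal log(1-q), so the power factors as exp(lam b
√x)(1-q)^lam with the same branch as the binomial series. -/
theorem hasSum_ramanujanIntegrand {υ b lam : ℂ} {y x : ℝ} (hb : 0 < b.re) (hx : 0 < x) :
    HasSum (fun k : ℕ => pochhammerCoeff lam k * ((x : ℂ) ^ (υ - 1) * (Real.cos (x * y) : ℂ) *
      Complex.exp (-((lam * b + b * k) * Real.sqrt x)))) (ramanujanIntegrand υ b lam y x) := by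
  set q : ℂ := Complex.exp (-(b * (Real.sqrt x : ℂ))) with hq
  have hq1 : ‖q‖ < 1 := by
    rw [hq, Complex.norm_exp, Real.exp_lt_one_iff]
    simpa using mul_pos hb (Real.sqrt_pos.mpr hx)
  have hne : 1 - q ≠ 0 := by
    intro h
    have := re_one_sub_exp_pos hb hx
    rw [← hq, h] at this
    simp at this
  have h := (hasSum_pochhammerCoeff_mul_pow lam hq1).mul_left
    ((x : ℂ) ^ (υ - 1) * (Real.cos (x * y) : ℂ) * Complex.exp (-(lam * b * Real.sqrt x)))
  have hval : (x : ℂ) ^ (υ - 1) * (Real.cos (x * y) : ℂ) *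
      Complex.exp (-(lam * b * Real.sqrt x)) * (1 / (1 - q) ^ lam) =
      ramanujanIntegrand υ b lam y x := by
    rw [ramanujanIntegrand, expSubOneLog, mul_add, Complex.exp_add, ← hq,
      Complex.cpow_def_of_ne_zero hne, mul_comm (Complex.log _), Complex.exp_neg, mul_assoc lam b]
    field_simp
  rw [hval] at h
  refine h.congr_fun fun k => ?_
  rw [hq, ← Complex.exp_nat_mul, show -((lam * b + b * k) * (Real.sqrt x : ℂ)) =
    -(lam * b * Real.sqrt x) + k * -(b * Real.sqrt x) by ring, Complex.exp_add]
  ring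

theorem integrableOn_cpow_mul_cos_mul_cexp_sqrt {υ s : ℂ} {y : ℝ} (hυ : 0 < υ.re)
    (hs : 0 < s.re) :
    IntegrableOn (fun x : ℝ => (x : ℂ) ^ (υ - 1) * (Real.cos (x * y) : ℂ) *
      Complex.exp (-(s * Real.sqrt x))) (Ioi 0) ∧
    ∫ x in Ioi (0 : ℝ), ‖(x : ℂ) ^ (υ - 1) * (Real.cos (x * y) : ℂ) *
      Complex.exp (-(s * Real.sqrt x))‖ ≤ s.re ^ (-(2 * υ.re)) * 2 * Real.Gamma (2 * υ.re) := by
  have hbound : ∀ x ∈ Ioi (0 : ℝ), ‖(x : ℂ) ^ (υ - 1) * (Real.cos (x * y) : ℂ) *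
      Complex.exp (-(s * Real.sqrt x))‖ ≤ x ^ (υ.re - 1) * Real.exp (-(s.re * Real.sqrt x)) := by
    intro x hx
    have hx : 0 < x := hx
    rw [mul_right_comm, norm_mul, norm_cpow_mul_cexp_neg_mul_sqrt υ s hx]
    refine mul_le_of_le_one_right (by positivity) ?_
    rw [Complex.norm_real]
    exact Real.abs_cos_le_one _
  have hint : IntegrableOn (fun x : ℝ => (x : ℂ) ^ (υ - 1) * (Real.cos (x * y) : ℂ) *
      Complex.exp (-(s * Real.sqrt x))) (Ioi 0) := by
    refine Integrable.mono' (integrableOn_rpow_mul_exp_neg_mul_sqrt hυ hs) ?_ ?_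
    · exact (by fun_prop : Measurable fun x : ℝ => (x : ℂ) ^ (υ - 1) * (Real.cos (x * y) : ℂ) *
        Complex.exp (-(s * Real.sqrt x))).aestronglyMeasurable
    · filter_upwards [ae_restrict_mem measurableSet_Ioi] with x hx using hbound x hx
  refine ⟨hint, ?_⟩
  rw [← integral_rpow_mul_exp_neg_mul_sqrt hυ hs]
  exact setIntegral_mono_on hint.norm (integrableOn_rpow_mul_exp_neg_mul_sqrt hυ hs)
    measurableSet_Ioi hbound

theorem ramanujanIntegrand_integrable_and_hasSum {υ b lam : ℂ} {y : ℝ} (hυ : 0 < υ.re)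
    (hlam : 0 < lam.re) (hb : 0 < b.re) (hconv_zero : lam.re < 2 * υ.re)
    (hconv_top : 0 < (lam * b).re) :
    IntegrableOn (ramanujanIntegrand υ b lam y) (Ioi 0) ∧
      HasSum (fun k : ℕ => pochhammerCoeff lam k * cosLaplaceSqrt υ (lam * b + b * k) y)
        (ramanujanIC υ b lam y) := by
  have hsre : ∀ k : ℕ, (lam * b + b * k).re = (lam * b).re + b.re * k := fun k => by simp
  have hs : ∀ k : ℕ, 0 < (lam * b + b * k).re := fun k => by rw [hsre]; positivity
  have hF := fun k : ℕ => integrableOn_cpow_mul_cos_mul_cexp_sqrt (y := y) hυ (hs k)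
  have h := integrable_and_hasSum_integral (μ := volume.restrict (Ioi (0 : ℝ)))
    (F := fun k x => pochhammerCoeff lam k * ((x : ℂ) ^ (υ - 1) * (Real.cos (x * y) : ℂ) *
      Complex.exp (-((lam * b + b * k) * Real.sqrt x)))) (f := ramanujanIntegrand υ b lam y)
    (fun k => (hF k).1.const_mul _) ?_ ?_ ?_
  · simp only [integral_const_mul] at h
    exact h
  · refine Summable.of_nonneg_of_le (fun k => integral_nonneg fun x => norm_nonneg _) (fun k => ?_)
      ((summable_norm_pochhammerCoeff_mul_rpow hlam hconv_top hb hconv_zero).mul_right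
        (2 * Real.Gamma (2 * υ.re)))
    simp only [norm_mul (pochhammerCoeff lam k)]
    rw [integral_const_mul, ← hsre, mul_assoc, ← mul_assoc _ 2]
    exact mul_le_mul_of_nonneg_left (hF k).2 (norm_nonneg _)
  · unfold ramanujanIntegrand expSubOneLog
    exact (by fun_prop : Measurable _).aestronglyMeasurable
  · filter_upwards [ae_restrict_mem measurableSet_Ioi] with x hx
    exact hasSum_ramanujanIntegrand hb hx

/-- Duplicating all Gamma factors reduces the second G-function to the first one. -/
theorem meijerGKernel_two_eight_eq (υ ζ : ℂ) :
    meijerGKernel 2 8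
      ![(8 - 2 * υ) / 8, (7 - 2 * υ) / 8, (6 - 2 * υ) / 8, (5 - 2 * υ) / 8,
        (4 - 2 * υ) / 8, (3 - 2 * υ) / 8, (2 - 2 * υ) / 8, (1 - 2 * υ) / 8]
      ![0, 1 / 2, 1 / 4, 3 / 4] ζ =
    (Real.pi : ℂ) ^ 2 * Complex.exp ((3 - 2 * υ - 4 * ζ) * Real.log 2) *
      meijerGKernel 1 4
        ![(4 - 2 * υ) / 4, (3 - 2 * υ) / 4, (2 - 2 * υ) / 4, (1 - 2 * υ) / 4] ![0, 1 / 2]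
        (2 * ζ) := by
  have h0 := Gamma_mul_Gamma_add_half_eq_cexp (-ζ)
  have h1 := Gamma_mul_Gamma_add_half_eq_cexp (1 / 4 + ζ)
  have g0 := Gamma_mul_Gamma_add_half_eq_cexp (υ / 4 + ζ)
  have g1 := Gamma_mul_Gamma_add_half_eq_cexp (υ / 4 + ζ + 1 / 8)
  have g2 := Gamma_mul_Gamma_add_half_eq_cexp (υ / 4 + ζ + 1 / 4)
  have g3 := Gamma_mul_Gamma_add_half_eq_cexp (υ / 4 + ζ + 3 / 8)
  rw [show υ / 4 + ζ + 1 / 8 + 1 / 2 = υ / 4 + ζ + 5 / 8 by ring] at g1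
  rw [show υ / 4 + ζ + 1 / 4 + 1 / 2 = υ / 4 + ζ + 3 / 4 by ring] at g2
  rw [show υ / 4 + ζ + 3 / 8 + 1 / 2 = υ / 4 + ζ + 7 / 8 by ring] at g3
  rw [show 1 / 4 + ζ + 1 / 2 = 3 / 4 + ζ by ring] at h1
  rw [meijerGKernel_one_four, meijerGKernel_two_eight]
  simp only [Matrix.cons_val]
  rw [show 1 - (8 - 2 * υ) / 8 + ζ = υ / 4 + ζ by ring,
    show 1 - (7 - 2 * υ) / 8 + ζ = υ / 4 + ζ + 1 / 8 by ring,
    show 1 - (6 - 2 * υ) / 8 + ζ = υ / 4 + ζ + 1 / 4 by ring,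
    show 1 - (5 - 2 * υ) / 8 + ζ = υ / 4 + ζ + 3 / 8 by ring,
    show 1 - (4 - 2 * υ) / 8 + ζ = υ / 4 + ζ + 1 / 2 by ring,
    show 1 - (3 - 2 * υ) / 8 + ζ = υ / 4 + ζ + 5 / 8 by ring,
    show 1 - (2 - 2 * υ) / 8 + ζ = υ / 4 + ζ + 3 / 4 by ring,
    show 1 - (1 - 2 * υ) / 8 + ζ = υ / 4 + ζ + 7 / 8 by ring,
    show (1 : ℂ) - 1 / 4 + ζ = 3 / 4 + ζ by ring, show (1 : ℂ) - 3 / 4 + ζ = 1 / 4 + ζ by ring,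
    zero_sub, zero_sub, show 1 / 2 - ζ = -ζ + 1 / 2 by ring, h0, mul_comm (Complex.Gamma (3 / 4 + ζ)),
    h1,
    show 1 - (4 - 2 * υ) / 4 + 2 * ζ = 2 * (υ / 4 + ζ) by ring,
    show 1 - (3 - 2 * υ) / 4 + 2 * ζ = 2 * (υ / 4 + ζ + 1 / 8) by ring,
    show 1 - (2 - 2 * υ) / 4 + 2 * ζ = 2 * (υ / 4 + ζ + 1 / 4) by ring,
    show 1 - (1 - 2 * υ) / 4 + 2 * ζ = 2 * (υ / 4 + ζ + 3 / 8) by ring,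
    show (1 : ℂ) - 1 / 2 + 2 * ζ = 2 * (1 / 4 + ζ) by ring, ← mul_neg,
    show ∀ a b c d e f g h : ℂ, a * b * c * d * e * f * g * h =
      (a * e) * (b * f) * (c * g) * (d * h) by intros; ring, g0, g1, g2, g3]
  have he : Complex.exp ((3 - 2 * υ - 4 * ζ) * Real.log 2) *
      Complex.exp ((1 - 2 * (1 / 4 + ζ)) * Real.log 2) =
      Complex.exp ((1 - 2 * -ζ) * Real.log 2) *
      Complex.exp ((1 - 2 * (υ / 4 + ζ)) * Real.log 2) *
      Complex.exp ((1 - 2 * (υ / 4 + ζ + 1 / 8)) * Real.log 2) *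
      Complex.exp ((1 - 2 * (υ / 4 + ζ + 1 / 4)) * Real.log 2) *
      Complex.exp ((1 - 2 * (υ / 4 + ζ + 3 / 8)) * Real.log 2) := by
    simp only [← Complex.exp_add]
    congr 1
    ring
  have hpi' : (Real.sqrt Real.pi : ℂ) ≠ 0 :=
    Complex.ofReal_ne_zero.mpr (Real.sqrt_pos.mpr Real.pi_pos).ne'
  have hexp := Complex.exp_ne_zero ((1 - 2 * (1 / 4 + ζ)) * Real.log 2)
  -- Five duplications in the numerator and one in the denominator leave (√π)^4 = π^2.
  rw [← ofReal_sqrt_pi_mul_self, ← div_div, ← div_div, div_eq_iff hpi', div_eq_iff hexp,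
    mul_right_comm _ _ (Complex.exp ((1 - 2 * (1 / 4 + ζ)) * Real.log 2)), ← mul_div_assoc,
    div_mul_eq_mul_div, div_mul_eq_mul_div]
  congr 1
  linear_combination (-((Real.sqrt Real.pi : ℂ) ^ 5 * Complex.Gamma (2 * -ζ) *
    Complex.Gamma (2 * (υ / 4 + ζ)) * Complex.Gamma (2 * (υ / 4 + ζ + 1 / 8)) *
    Complex.Gamma (2 * (υ / 4 + ζ + 1 / 4)) * Complex.Gamma (2 * (υ / 4 + ζ + 3 / 8)))) * he

theorem HasMeijerG.two_eight {υ w g : ℂ} (hυ : 0 < υ.re)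
    (h : HasMeijerG 1 4
      ![(4 - 2 * υ) / 4, (3 - 2 * υ) / 4, (2 - 2 * υ) / 4, (1 - 2 * υ) / 4] ![0, 1 / 2] w g) :
    HasMeijerG 2 8
      ![(8 - 2 * υ) / 8, (7 - 2 * υ) / 8, (6 - 2 * υ) / 8, (5 - 2 * υ) / 8,
        (4 - 2 * υ) / 8, (3 - 2 * υ) / 8, (2 - 2 * υ) / 8, (1 - 2 * υ) / 8]
      ![0, 1 / 2, 1 / 4, 3 / 4] (2 * w + 4 * Real.log 2)
      ((Real.pi : ℂ) ^ 2 * Complex.exp ((2 - 2 * υ) * Real.log 2) * g) := by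
  refine ⟨⟨-υ.re / 8, meijerGSeparates_two_eight_iff.mpr ⟨by linarith, by linarith⟩⟩,
    fun σ hσ => ?_⟩
  obtain ⟨hσ1, hσ2⟩ := meijerGSeparates_two_eight_iff.mp hσ
  obtain ⟨hi, hg⟩ := h.2 (2 * σ) (meijerGSeparates_one_four_iff.mpr ⟨by linarith, by linarith⟩)
  set K : ℝ → ℂ := fun τ => meijerGKernel 1 4
      ![(4 - 2 * υ) / 4, (3 - 2 * υ) / 4, (2 - 2 * υ) / 4, (1 - 2 * υ) / 4] ![0, 1 / 2]
      ((2 * σ : ℝ) + τ * Complex.I) * Complex.exp (((2 * σ : ℝ) + τ * Complex.I) * w) with hK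
  -- The term 4 log 2 in the new argument cancels 2^(-4ζ) from the duplications. The leading 2 will
  -- cancel the Jacobian 1/2 of τ ↦ 2τ.
  have hker : ∀ τ : ℝ, meijerGKernel 2 8
      ![(8 - 2 * υ) / 8, (7 - 2 * υ) / 8, (6 - 2 * υ) / 8, (5 - 2 * υ) / 8,
        (4 - 2 * υ) / 8, (3 - 2 * υ) / 8, (2 - 2 * υ) / 8, (1 - 2 * υ) / 8]
      ![0, 1 / 2, 1 / 4, 3 / 4] (σ + τ * Complex.I) *
      Complex.exp ((σ + τ * Complex.I) * (2 * w + 4 * Real.log 2)) =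
      2 * ((Real.pi : ℂ) ^ 2 * Complex.exp ((2 - 2 * υ) * Real.log 2)) * K (2 * τ) := fun τ => by
    have hu : 2 * (σ + τ * Complex.I) = (2 * σ : ℝ) + (2 * τ : ℝ) * Complex.I := by
      push_cast
      ring
    have h2 : Complex.exp (Real.log 2) = 2 := by
      rw [← Complex.ofReal_exp, Real.exp_log two_pos, Complex.ofReal_ofNat]
    have he : Complex.exp ((3 - 2 * υ - 4 * (σ + τ * Complex.I)) * Real.log 2) *
        Complex.exp ((σ + τ * Complex.I) * (2 * w + 4 * Real.log 2)) =
        Complex.exp (Real.log 2) * Complex.exp ((2 - 2 * υ) * Real.log 2) *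
          Complex.exp (2 * (σ + τ * Complex.I) * w) := by
      simp only [← Complex.exp_add]
      congr 1
      ring
    rw [h2] at he
    rw [meijerGKernel_two_eight_eq, hK]
    simp only
    rw [← hu]
    linear_combination ((Real.pi : ℂ) ^ 2 * meijerGKernel 1 4
      ![(4 - 2 * υ) / 4, (3 - 2 * υ) / 4, (2 - 2 * υ) / 4, (1 - 2 * υ) / 4] ![0, 1 / 2]
      (2 * (σ + τ * Complex.I))) * he
  simp only [hker]
  refine ⟨(hi.comp_mul_left' two_ne_zero).const_mul _, ?_⟩
  change 1 / (2 * (Real.pi : ℂ) * Complex.I) * ∫ τ : ℝ, K τ * Complex.I = g at hg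
  rw [integral_mul_const] at hg
  rw [integral_mul_const, integral_const_mul, Measure.integral_comp_mul_left (fun τ => K τ),
    Complex.real_smul, abs_of_pos (by norm_num), ← hg]
  push_cast
  ring

/-! ### Assembling the five series. -/

theorem isMeijerGSeries_of_hasSum {p q m n : ℕ} {α : Fin p → ℂ} {β : Fin q → ℂ} {I C : ℂ}
    {c w g t : ℕ → ℂ} (hg : ∀ k, HasMeijerG m n α β (w k) (g k)) (hC : C ≠ 0)
    (ht : ∀ k, C * (c k * g k) = t k) (hI : HasSum t I) : IsMeijerGSeries I C c m n α β w := by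
  have hval : ∀ k, meijerG m n α β (w k) = g k := fun k => (hg k).meijerG_eq
  have hI' : HasSum (fun k => C * (c k * g k)) I := by simpa only [ht] using hI
  have hs : Summable fun k => c k * g k := (summable_mul_left_iff hC).mp hI'.summable
  refine ⟨fun k => ⟨g k, hg k⟩, by simpa only [hval] using hs, ?_⟩
  simp only [hval]
  rw [← tsum_mul_left, hI'.tsum_eq]

/-- Bookkeeping of exponents: A belongs to the prefactor, D to the power of s_k, E to the factor z^δ
of a shift and F to the value of the unshifted G-function. Each series then reduces to a linear
identity. -/
theorem cexp_div_pi_mul_eq {A D E F c J : ℂ} (h : A + E + F = D) :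
    Complex.exp A / Real.pi * (c / Complex.exp D *
      (Complex.exp E * (Real.pi * Complex.exp F * J))) = c * J := by
  have hpi : (Real.pi : ℂ) ≠ 0 := Complex.ofReal_ne_zero.mpr Real.pi_pos.ne'
  rw [← h, Complex.exp_add, Complex.exp_add]
  have hA := Complex.exp_ne_zero A
  have hE := Complex.exp_ne_zero E
  have hF := Complex.exp_ne_zero F
  field_simp

theorem cexp_div_pi_cube_mul_eq {A D E F c J : ℂ} (h : A + E + F = D) :
    Complex.exp A / (Real.pi : ℂ) ^ 3 * (c / Complex.exp D *
      ((Real.pi : ℂ) ^ 2 * Complex.exp E * (Real.pi * Complex.exp F * J))) = c * J := by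
  have hpi : (Real.pi : ℂ) ≠ 0 := Complex.ofReal_ne_zero.mpr Real.pi_pos.ne'
  rw [← cexp_div_pi_mul_eq (c := c) (J := J) h]
  field_simp

theorem theorem2 (υ b lam : ℂ) (y : ℝ)
    (hυ : 0 < υ.re) (hy : 0 < y) (hlam : 0 < lam.re) (hb : 0 < b.re)
    (hconv_zero : lam.re < 2 * υ.re) (hconv_top : 0 < (lam * b).re) :
    IntegrableOn (ramanujanIntegrand υ b lam y) (Ioi 0) ∧
    IsMeijerGSeries (ramanujanIC υ b lam y)
      ((2 : ℂ) ^ (4 * υ - 3 / 2) / Real.pi)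
      (fun k => pochhammerCoeff lam k / (lam * b + b * k) ^ (2 * υ)) 1 4
      ![(4 - 2 * υ) / 4, (3 - 2 * υ) / 4, (2 - 2 * υ) / 4, (1 - 2 * υ) / 4]
      ![0, 1 / 2]
      (fun k => logDivPow (64 * y ^ 2) (lam * b + b * k) 4) ∧
    IsMeijerGSeries (ramanujanIC υ b lam y)
      ((2 : ℂ) ^ (4 * υ) * Real.sqrt y / Real.pi)
      (fun k => pochhammerCoeff lam k / (lam * b + b * k) ^ (2 * υ + 1)) 1 4
      ![(3 - 2 * υ) / 4, (2 - 2 * υ) / 4, (1 - 2 * υ) / 4, (-2 * υ) / 4]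
      ![-1 / 4, 1 / 4]
      (fun k => logDivPow (64 * y ^ 2) (lam * b + b * k) 4) ∧
    IsMeijerGSeries (ramanujanIC υ b lam y)
      ((2 : ℂ) ^ (4 * υ - 9 / 2) / (Real.pi * y))
      (fun k => pochhammerCoeff lam k / (lam * b + b * k) ^ (2 * υ - 2)) 1 4
      ![(6 - 2 * υ) / 4, (5 - 2 * υ) / 4, (4 - 2 * υ) / 4, (3 - 2 * υ) / 4]
      ![1 / 2, 1]
      (fun k => logDivPow (64 * y ^ 2) (lam * b + b * k) 4) ∧
    IsMeijerGSeries (ramanujanIC υ b lam y)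
      (y * (2 : ℂ) ^ (4 * υ + 3 / 2) / Real.pi)
      (fun k => pochhammerCoeff lam k / (lam * b + b * k) ^ (2 * υ + 2)) 1 4
      ![(2 - 2 * υ) / 4, (1 - 2 * υ) / 4, (-2 * υ) / 4, (-1 - 2 * υ) / 4]
      ![-1 / 2, 0]
      (fun k => logDivPow (64 * y ^ 2) (lam * b + b * k) 4) ∧
    IsMeijerGSeries (ramanujanIC υ b lam y)
      ((2 : ℂ) ^ (6 * υ - 7 / 2) / (Real.pi : ℂ) ^ 3)
      (fun k => pochhammerCoeff lam k / (lam * b + b * k) ^ (2 * υ)) 2 8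
      ![(8 - 2 * υ) / 8, (7 - 2 * υ) / 8, (6 - 2 * υ) / 8, (5 - 2 * υ) / 8,
        (4 - 2 * υ) / 8, (3 - 2 * υ) / 8, (2 - 2 * υ) / 8, (1 - 2 * υ) / 8]
      ![0, 1 / 2, 1 / 4, 3 / 4]
      (fun k => logDivPow (4 ^ 8 * y ^ 4) (lam * b + b * k) 8) := by
  obtain ⟨hint, hsum⟩ := ramanujanIntegrand_integrable_and_hasSum (y := y) hυ hlam hb hconv_zero
    hconv_top
  have hs : ∀ k : ℕ, 0 < (lam * b + b * k).re := fun k => by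
    have : (lam * b + b * k).re = (lam * b).re + b.re * k := by simp
    rw [this]
    positivity
  have hs0 : ∀ k : ℕ, lam * b + b * k ≠ 0 := fun k h => by
    have := hs k
    rw [h] at this
    simp at this
  have hG := fun k : ℕ => hasMeijerG_one_four hυ (hs k) hy
  have hpi : (Real.pi : ℂ) ≠ 0 := Complex.ofReal_ne_zero.mpr Real.pi_pos.ne'
  have hy0 : (y : ℂ) ≠ 0 := Complex.ofReal_ne_zero.mpr hy.ne'
  have hye : (y : ℂ) = Complex.exp (Real.log y) := by rw [← Complex.ofReal_exp, Real.exp_log hy]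
  have hsqrt : (Real.sqrt y : ℂ) = Complex.exp (Real.log y / 2) := by
    rw [← Real.exp_log (Real.sqrt_pos.mpr hy), Real.log_sqrt hy.le]
    push_cast
    rfl
  refine ⟨hint, ?_, ?_, ?_, ?_, ?_⟩
  · refine isMeijerGSeries_of_hasSum hG (by simp [hpi]) (fun k => ?_) hsum
    -- The unshifted case: a factor exp 0 plays the role of z^δ.
    rw [two_cpow_eq_cexp, Complex.cpow_def_of_ne_zero (hs0 k),
      ← one_mul (Real.pi * _ * cosLaplaceSqrt _ _ _), ← Complex.exp_zero]
    exact cexp_div_pi_mul_eq (by ring)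
  -- Here z^(-1/4) = s_k/(2^(3/2) √y), which accounts for √y and the extra power of s_k; the shifts
  -- 1/2 and -1/2 below bring in (8y/s_k^2)^(±1) likewise.
  · have hG' := fun k => (hG k).add_const (-1 / 4)
      (α' := ![(3 - 2 * υ) / 4, (2 - 2 * υ) / 4, (1 - 2 * υ) / 4, (-2 * υ) / 4])
      (β' := ![-1 / 4, 1 / 4])
      (fun j => by fin_cases j <;> simp <;> ring)
      (fun j => by fin_cases j <;> simp <;> norm_num)
    refine isMeijerGSeries_of_hasSum hG' ?_ (fun k => ?_) hsum
    · rw [hsqrt]; simp [hpi]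
    · rw [two_cpow_eq_cexp, Complex.cpow_def_of_ne_zero (hs0 k), hsqrt, ← Complex.exp_add,
        logDivPow_sq hy]
      exact cexp_div_pi_mul_eq (by push_cast; ring)
  · have hG' := fun k => (hG k).add_const (1 / 2)
      (α' := ![(6 - 2 * υ) / 4, (5 - 2 * υ) / 4, (4 - 2 * υ) / 4, (3 - 2 * υ) / 4])
      (β' := ![1 / 2, 1])
      (fun j => by fin_cases j <;> simp <;> ring)
      (fun j => by fin_cases j <;> simp <;> norm_num)
    refine isMeijerGSeries_of_hasSum hG' ?_ (fun k => ?_) hsum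
    · simp [hpi, hy0]
    · rw [two_cpow_eq_cexp, Complex.cpow_def_of_ne_zero (hs0 k), hye, mul_comm (Real.pi : ℂ),
        ← div_div, ← Complex.exp_sub, logDivPow_sq hy]
      exact cexp_div_pi_mul_eq (by push_cast; ring)
  · have hG' := fun k => (hG k).add_const (-1 / 2)
      (α' := ![(2 - 2 * υ) / 4, (1 - 2 * υ) / 4, (-2 * υ) / 4, (-1 - 2 * υ) / 4])
      (β' := ![-1 / 2, 0])
      (fun j => by fin_cases j <;> simp <;> ring)
      (fun j => by fin_cases j <;> simp <;> norm_num)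
    refine isMeijerGSeries_of_hasSum hG' ?_ (fun k => ?_) hsum
    · simp [hpi, hy0]
    · rw [two_cpow_eq_cexp, Complex.cpow_def_of_ne_zero (hs0 k), hye, ← Complex.exp_add,
        logDivPow_sq hy]
      exact cexp_div_pi_mul_eq (by push_cast; ring)
  · have hG' := fun k => (hG k).two_eight hυ
    simp only [← logDivPow_pow_four hy] at hG'
    refine isMeijerGSeries_of_hasSum hG' ?_ (fun k => ?_) hsum
    · simp [hpi]
    · rw [two_cpow_eq_cexp, Complex.cpow_def_of_ne_zero (hs0 k)]
      exact cexp_div_pi_cube_mul_eq (by ring)
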